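/- Let $k$ be a field of characteristic $0$, let $m\ge 1$, and let $\varphi'$ be a regular (nondegenerate) quadratic form over $k$ in $m$ variables. Put $\psi=\langle 1,-1\rangle\perp\varphi'$ and $\varphi=\langle 1\rangle\perp(-\varphi')$, and let $Q^{\psi}\subset\mathbb A^{m+2}_k$ be the affine quadric $\psi(y_1,\dots,y_{m+2})=1$. With $x_1=y_1+y_2$, $x_2=y_1-y_2$ and $x_i=y_i$ for $i\ge 3$, this is the hypersurface $x_1x_2=\varphi(1,x_3,\dots,x_{m+2})$. Let $\mathcal S(Q^{\psi})$ denote the sheaf of naive $\mathbb A^1$-connected components of $Q^{\psi}$, i.e. the Nisnevich sheafification, on the category of smooth $k$-schemes of finite type, of the presheaf $U\mapsto Q^{\psi}(U)/\!\sim$, where $\sim$ is the equivalence relation generated by $h|_{0\times U}\sim h|_{1\times U}$ for $h\in Q^{\psi}(\mathbb A^1_k\times U)$. For a finitely generated field extension $F/k$ let $\mathcal S(Q^{\psi})(F)$ be the set of its sections over $\operatorname{Spec}F$, i.e. the colimit of $\mathcal S(Q^{\psi})(\operatorname{Spec}A)$ over the smooth $k$-subalgebras $A\subset F$ of finite type with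 fraction field $F$; every point $P\in Q^{\psi}(F)$ has a class $[P]\in\mathcal S(Q^{\psi})(F)$. Let $\langle D(\varphi_F)\rangle$ be the subgroup of $F^*$ generated by the nonzero values of $\varphi_F=\varphi\otimes_k F$. Then for every finitely generated field extension $F/k$ there is a bijection $$\mathcal S(Q^{\psi})(F)\;\xrightarrow{\ \sim\ }\;F^*/\langle D(\varphi_F)\rangle$$ which sends $[P]$ to $x_1(P)\,\langle D(\varphi_F)\rangle$ for every $P\in Q^{\psi}(F)$ with $x_1(P)\neq 0$. If $\varphi_F$ is anisotropic, then $x_1(P)\ne 0$ for all $P\in Q^{\psi}(F)$; if $\varphi_F$ is isotropic, then $\langle D(\varphi_F)\rangle=F^*$, so the target is a single point. -/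

import Mathlib

open CategoryTheory Limits AlgebraicGeometry Opposite
open scoped TensorProduct

universe u w

noncomputable section

/-! ## Smooth schemes of finite type and the Nisnevich topology -/

namespace NaiveA1

/-- `f : Y ⟶ X` splits at `x`: some point `y` of `Y` lies over `x` and has the same residue field,
`κ(x) ≅ κ(y)`. -/
def SplitsAt {X Y : Scheme.{u}} (f : Y ⟶ X) (x : X) : Prop :=
  ∃ y : Y, f y = x ∧ Function.Bijective (f.residueFieldMap y).hom

/-- `f` splits at `x` exactly when the `κ(x)`-point `x` of `X` lifts along `f`. -/
lemma splitsAt_iff_exists_lift {X Y : Scheme.{u}} (f : Y ⟶ X) (x : X) :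
    SplitsAt f x ↔ ∃ s : Spec (X.residueField x) ⟶ Y, s ≫ f = X.fromSpecResidueField x := by
  constructor
  · rintro ⟨y, rfl, hy⟩
    have : IsIso (f.residueFieldMap y) := by
      rw [ConcreteCategory.isIso_iff_bijective]
      exact hy
    refine ⟨Spec.map (inv (f.residueFieldMap y)) ≫ Y.fromSpecResidueField y, ?_⟩
    rw [Category.assoc, ← Scheme.Hom.SpecMap_residueFieldMap_fromSpecResidueField,
      ← Spec.map_comp_assoc]
    simp
  · rintro ⟨s, hs⟩
    obtain ⟨⟨y, a⟩, rfl⟩ := (Scheme.SpecToEquivOfField (X.residueField x) Y).symm.surjective s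
    have hs' : (Scheme.SpecToEquivOfField (X.residueField x) X).symm
          ⟨f y, f.residueFieldMap y ≫ a⟩ =
        (Scheme.SpecToEquivOfField (X.residueField x) X).symm ⟨x, 𝟙 _⟩ := by
      simp only [Scheme.SpecToEquivOfField, Equiv.coe_fn_symm_mk] at hs ⊢
      rw [Spec.map_comp, Category.assoc, Scheme.Hom.SpecMap_residueFieldMap_fromSpecResidueField,
        ← Category.assoc, hs]
      exact (by rw [Spec.map_id, Category.id_comp] :
        X.fromSpecResidueField x = Spec.map (𝟙 _) ≫ X.fromSpecResidueField x)
    obtain ⟨hyx, hc⟩ := Sigma.mk.inj ((Equiv.injective _) hs')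
    subst hyx
    refine ⟨y, rfl, (f.residueFieldMap y).hom.injective, fun b => ⟨a.hom b, ?_⟩⟩
    have hc' := eq_of_heq hc
    apply a.hom.injective
    exact congr($(hc').hom (a.hom b))

variable (k : Type u) [Field k]

/-- Smooth morphisms of finite type. -/
def smoothFiniteType : MorphismProperty Scheme.{u} := @Smooth ⊓ @QuasiCompact

/-- The category `Sm/k` of smooth `k`-schemes of finite type. -/
abbrev Sm : Type (u + 1) := (smoothFiniteType.{u}).Over ⊤ (Spec (.of k))

/-- A smooth `k`-scheme of finite type as an object of `Sm/k`. -/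
def Sm.mk {X : Scheme.{u}} (f : X ⟶ Spec (.of k)) [hs : Smooth f] [hq : QuasiCompact f] : Sm k :=
  MorphismProperty.Over.mk ⊤ f ⟨hs, hq⟩

variable {k}

instance (X : Sm k) : Smooth X.hom := X.prop.1
instance (X : Sm k) : QuasiCompact X.hom := X.prop.2

lemma Sm.noetherian (X : Sm k) : TopologicalSpace.NoetherianSpace X.left := by
  let f : X.left ⟶ Spec (.of k) := X.hom
  have : Smooth f := X.prop.1
  have : QuasiCompact f := X.prop.2
  have : IsLocallyNoetherian X.left := LocallyOfFiniteType.isLocallyNoetherian f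
  have : CompactSpace X.left := QuasiCompact.compactSpace_of_compactSpace f
  have : IsNoetherian X.left := {}
  infer_instance

/-- The Nisnevich topology on `Sm/k`: a sieve on `X` is covering when for every point `x` of `X`
it contains an étale morphism `Y ⟶ X` which has a point over `x` with residue field `κ(x)`. -/
def nisnevichTopology (k : Type u) [Field k] : GrothendieckTopology (Sm k) where
  sieves X := {R | ∀ x : X.left, ∃ (Y : Sm k) (f : Y ⟶ X),
    R f ∧ Etale f.left ∧ SplitsAt f.left x}
  top_mem' X x := ⟨X, 𝟙 X, trivial, (inferInstance : Etale (𝟙 X.left)), by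
    rw [splitsAt_iff_exists_lift]
    exact ⟨X.left.fromSpecResidueField x, by simp⟩⟩
  pullback_stable' X X' R g hR x := by
    obtain ⟨Y, f, hf, hfe, hs⟩ := hR (g.left x)
    rw [splitsAt_iff_exists_lift] at hs
    obtain ⟨s, hs⟩ := hs
    have := Y.noetherian
    have : QuasiCompact f.left := inferInstance
    let Z : Sm k := Sm.mk k (pullback.fst g.left f.left ≫ X'.hom)
    let p : Z ⟶ X' := MorphismProperty.Over.homMk (pullback.fst g.left f.left) rfl
    have hw : pullback.snd g.left f.left ≫ Y.hom = pullback.fst g.left f.left ≫ X'.hom := by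
      rw [← MorphismProperty.Over.w f, ← pullback.condition_assoc, MorphismProperty.Over.w g]
    let q : Z ⟶ Y := MorphismProperty.Over.homMk (pullback.snd g.left f.left) hw
    have hpq : p ≫ g = q ≫ f := by
      ext1
      exact pullback.condition
    refine ⟨Z, p, ?_, (inferInstance : Etale (pullback.fst g.left f.left)), ?_⟩
    · change R (p ≫ g)
      rw [hpq]
      exact R.downward_closed hf _
    · rw [splitsAt_iff_exists_lift]
      refine ⟨pullback.lift (X'.left.fromSpecResidueField x)
        (Spec.map (g.left.residueFieldMap x) ≫ s) ?_, pullback.lift_fst _ _ _⟩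
      rw [Category.assoc, hs, Scheme.Hom.SpecMap_residueFieldMap_fromSpecResidueField]
  transitive' X R hR T hT x := by
    obtain ⟨Y, f, hf, hfe, y, rfl, hy⟩ := hR x
    obtain ⟨Z, g, hg, hge, z, rfl, hz⟩ := hT hf y
    refine ⟨Z, g ≫ f, hg, (inferInstance : Etale (g.left ≫ f.left)), z, rfl, ?_⟩
    change Function.Bijective ((g.left ≫ f.left).residueFieldMap z).hom
    rw [Scheme.residueFieldMap_comp]
    exact hz.comp hy

/-! ## Naive `𝔸¹`-connected components -/

lemma smooth_affineLine (X : Scheme.{u}) : Smooth (𝔸(PUnit.{u + 1}; X) ↘ X) := by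
  change Smooth (pullback.fst (terminal.from X) (terminal.from _))
  suffices Smooth (terminal.from
      (Spec (CommRingCat.of (MvPolynomial PUnit.{u + 1} (ULift.{u} ℤ))))) from inferInstance
  have := isIso_of_isTerminal specULiftZIsTerminal.{u} terminalIsTerminal (terminal.from _)
  rw [← terminal.comp_from (Spec.map (CommRingCat.ofHom MvPolynomial.C))]
  suffices Smooth (Spec.map (CommRingCat.ofHom
      (MvPolynomial.C (σ := PUnit.{u + 1}) (R := ULift.{u} ℤ)))) from inferInstance
  rw [HasRingHomProperty.Spec_iff (P := @Smooth), CommRingCat.hom_ofHom]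
  change (algebraMap (ULift.{u} ℤ) (MvPolynomial PUnit.{u + 1} (ULift.{u} ℤ))).Smooth
  rw [RingHom.smooth_algebraMap]
  exact {}

/-- The affine line `𝔸¹ × X` over `X`, as an object of `Sm/k`. -/
def affineLine (X : Sm k) : Sm k :=
  have := smooth_affineLine X.left
  Sm.mk k ((𝔸(PUnit.{u + 1}; X.left) ↘ X.left) ≫ X.hom)

/-- The morphism `𝔸¹ × X ⟶ 𝔸¹ × Y` induced by `f : X ⟶ Y`. -/
def affineLineMap {X Y : Sm k} (f : X ⟶ Y) : affineLine X ⟶ affineLine Y :=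
  MorphismProperty.Over.homMk (AffineSpace.map PUnit.{u + 1} f.left)
    ((AffineSpace.map_over_assoc f.left Y.hom).trans
      (congrArg (_ ≫ ·) (MorphismProperty.Over.w f)))

/-- The section `x ↦ (0, x)` of `𝔸¹ × X ⟶ X`. -/
def zeroSection (X : Sm k) : X ⟶ affineLine X :=
  MorphismProperty.Over.homMk (AffineSpace.homOfVector (𝟙 X.left) fun _ => 0)
    ((AffineSpace.homOfVector_over_assoc (𝟙 X.left) _ X.hom).trans (Category.id_comp _))

/-- The section `x ↦ (1, x)` of `𝔸¹ × X ⟶ X`. -/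
def oneSection (X : Sm k) : X ⟶ affineLine X :=
  MorphismProperty.Over.homMk (AffineSpace.homOfVector (𝟙 X.left) fun _ => 1)
    ((AffineSpace.homOfVector_over_assoc (𝟙 X.left) _ X.hom).trans (Category.id_comp _))

lemma zeroSection_naturality {X Y : Sm k} (f : X ⟶ Y) :
    f ≫ zeroSection Y = zeroSection X ≫ affineLineMap f := by
  ext1
  change f.left ≫ AffineSpace.homOfVector _ _ =
    AffineSpace.homOfVector _ _ ≫ AffineSpace.map _ f.left
  apply AffineSpace.hom_ext
  · simp
  · intro i
    rw [Scheme.Hom.comp_appTop, Scheme.Hom.comp_appTop, CommRingCat.comp_apply,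
      CommRingCat.comp_apply, AffineSpace.map_appTop_coord, AffineSpace.homOfVector_appTop_coord,
      AffineSpace.homOfVector_appTop_coord]
    simp

lemma oneSection_naturality {X Y : Sm k} (f : X ⟶ Y) :
    f ≫ oneSection Y = oneSection X ≫ affineLineMap f := by
  ext1
  change f.left ≫ AffineSpace.homOfVector _ _ =
    AffineSpace.homOfVector _ _ ≫ AffineSpace.map _ f.left
  apply AffineSpace.hom_ext
  · simp
  · intro i
    rw [Scheme.Hom.comp_appTop, Scheme.Hom.comp_appTop, CommRingCat.comp_apply,
      CommRingCat.comp_apply, AffineSpace.map_appTop_coord, AffineSpace.homOfVector_appTop_coord,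
      AffineSpace.homOfVector_appTop_coord]
    simp

/-- Two sections of a presheaf over `X` are `𝔸¹`-homotopic if they are the restrictions to `0`
and `1` of a section over `𝔸¹ × X`. -/
def Homotopic (P : (Sm k)ᵒᵖ ⥤ Type w) (X : Sm k) (a b : P.obj (op X)) : Prop :=
  ∃ h : P.obj (op (affineLine X)),
    P.map (zeroSection X).op h = a ∧ P.map (oneSection X).op h = b

lemma Homotopic.map {P : (Sm k)ᵒᵖ ⥤ Type w} {X Y : Sm k} (f : X ⟶ Y) {a b : P.obj (op Y)}
    (h : Homotopic P Y a b) : Homotopic P X (P.map f.op a) (P.map f.op b) := by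
  obtain ⟨h, rfl, rfl⟩ := h
  refine ⟨P.map (affineLineMap f).op h, ?_, ?_⟩
  · rw [← ConcreteCategory.comp_apply, ← P.map_comp, ← ConcreteCategory.comp_apply,
      ← P.map_comp, ← op_comp, ← op_comp, zeroSection_naturality]
  · rw [← ConcreteCategory.comp_apply, ← P.map_comp, ← ConcreteCategory.comp_apply,
      ← P.map_comp, ← op_comp, ← op_comp, oneSection_naturality]

/-- The presheaf `X ↦ P(X)/∼`, where `∼` is the equivalence relation generated by
`𝔸¹`-homotopy, that is, `𝔸¹`-chain homotopy. -/
def naivePre (P : (Sm k)ᵒᵖ ⥤ Type w) : (Sm k)ᵒᵖ ⥤ Type w where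
  obj X := Quot (Homotopic P X.unop)
  map f := ↾(Quot.map (P.map f) fun _ _ h => h.map f.unop)
  map_id X := by
    ext ⟨a⟩
    exact congrArg (Quot.mk _) (by simp)
  map_comp f g := by
    ext ⟨a⟩
    exact congrArg (Quot.mk _) (by simp)

/-- The quotient map `P ⟶ naivePre P`. -/
def toNaivePre (P : (Sm k)ᵒᵖ ⥤ Type w) : P ⟶ naivePre P where
  app _ := ↾(Quot.mk _)
  naturality _ _ _ := rfl

/-- The sheaf `𝒮(P)` of naive `𝔸¹`-connected components: the Nisnevich sheafification of the
presheaf of `𝔸¹`-chain homotopy classes. -/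
def naiveComponents (P : (Sm k)ᵒᵖ ⥤ Type (u + 1)) : Sheaf (nisnevichTopology k) (Type (u + 1)) :=
  (presheafToSheaf (nisnevichTopology k) (Type (u + 1))).obj (naivePre P)

/-- The canonical map `P ⟶ 𝒮(P)`. -/
def toNaiveComponents (P : (Sm k)ᵒᵖ ⥤ Type (u + 1)) : P ⟶ (naiveComponents P).obj :=
  toNaivePre P ≫ CategoryTheory.toSheafify (nisnevichTopology k) (naivePre P)

/-- The functor of points on `Sm/k` of a `k`-scheme `X`: it sends `U` to the set of `k`-morphisms
`U ⟶ X` (lifted to a larger universe). -/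
def pointFunctor (X : Over (Spec (.of k))) : (Sm k)ᵒᵖ ⥤ Type (u + 1) :=
  (MorphismProperty.Over.forget _ ⊤ (Spec (.of k))).op ⋙ uliftYoneda.{u + 1}.obj X

/-! ## Sections over a finitely generated field -/

variable (k) in
/-- The smooth affine models of `F/k`: smooth `k`-subalgebras `A` of `F` (of finite type) with
fraction field `F`, ordered by inclusion. -/
abbrev SmoothModel (F : Type u) [Field F] [Algebra k F] : Type u :=
  {A : Subalgebra k F // Algebra.Smooth k A ∧ IsFractionRing A F}

variable {F : Type u} [Field F] [Algebra k F]

/-- The smooth `k`-scheme `Spec A` attached to a smooth affine model `A` of `F`. -/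
def SmoothModel.spec (A : SmoothModel k F) : Sm k :=
  have : Smooth (Spec.map (CommRingCat.ofHom (algebraMap k A.1))) := by
    rw [HasRingHomProperty.Spec_iff (P := @Smooth), CommRingCat.hom_ofHom,
      RingHom.smooth_algebraMap]
    exact A.2.1
  Sm.mk k (Spec.map (CommRingCat.ofHom (algebraMap k A.1)))

/-- The functor `A ↦ Spec A`; an inclusion `A ≤ B` is sent to the morphism
`Spec B ⟶ Spec A`. -/
def modelFunctor (k F : Type u) [Field k] [Field F] [Algebra k F] :
    SmoothModel k F ⥤ (Sm k)ᵒᵖ where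
  obj A := op A.spec
  map {A B} h := Quiver.Hom.op (MorphismProperty.Over.homMk (A := B.spec) (B := A.spec)
    (Spec.map (CommRingCat.ofHom (Subalgebra.inclusion (leOfHom h)).toRingHom)) (by
      change Spec.map _ ≫ Spec.map _ = Spec.map _
      rw [← Spec.map_comp]
      rfl))
  map_id A := by
    apply Quiver.Hom.unop_inj
    ext1
    change Spec.map _ = 𝟙 _
    rw [← Spec.map_id]
    rfl
  map_comp f g := by
    apply Quiver.Hom.unop_inj
    ext1
    change Spec.map _ = Spec.map _ ≫ Spec.map _
    rw [← Spec.map_comp]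
    rfl

/-- The sections `P(F) = colim P(Spec A)` of a presheaf `P` on `Sm/k` over `Spec F`, the colimit
being taken over the smooth affine models `A` of `F/k`. -/
def fieldSections (P : (Sm k)ᵒᵖ ⥤ Type (u + 1)) (F : Type u) [Field F] [Algebra k F] :
    Type (u + 1) :=
  colimit (modelFunctor k F ⋙ P)

/-- The germ in `P(F)` of a section of `P` over `Spec A`. -/
def germ (P : (Sm k)ᵒᵖ ⥤ Type (u + 1)) (A : SmoothModel k F) (s : P.obj (op A.spec)) :
    fieldSections P F :=
  colimit.ι (modelFunctor k F ⋙ P) A s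

/-- The set `𝒮(X)(F)` of sections over `Spec F` of the sheaf of naive `𝔸¹`-connected components
of a `k`-scheme `X`. -/
abbrev componentsAt (X : Over (Spec (.of k))) (F : Type u) [Field F] [Algebra k F] :
    Type (u + 1) :=
  fieldSections (naiveComponents (pointFunctor X)).obj F

/-- For a `k`-scheme `X`, the element `s` of `𝒮(X)(F)` is the class `[P]` of the `F`-point `P` of
`X`: for some smooth affine model `A` of `F`, the point `P` extends to a morphism `Spec A ⟶ X`
over `k`, and `s` is the germ of the image of this morphism in `𝒮(X)(Spec A)`. -/
def IsClassOf (X : Over (Spec (.of k)))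
    (P : Over.mk (Spec.map (CommRingCat.ofHom (algebraMap k F))) ⟶ X)
    (s : componentsAt X F) : Prop :=
  ∃ (A : SmoothModel k F)
    (f : Over.mk (Spec.map (CommRingCat.ofHom (algebraMap k A.1))) ⟶ X),
    Spec.map (CommRingCat.ofHom A.1.val.toRingHom) ≫ f.left = P.left ∧
    s = germ _ A ((toNaiveComponents (pointFunctor X)).app (op A.spec) (ULift.up f))

end NaiveA1

/-! ## Quadratic forms and affine quadrics -/

namespace AffineQuadric

open NaiveA1

variable {k : Type u} [Field k] {n : ℕ}

/-- The one-dimensional quadratic form `⟨a⟩`, orthogonally added to `q`: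
`⟨a⟩ ⊥ q` is the form `v ↦ a v₀² + q(v₁, …, vₙ)`. -/
def consForm (a : k) (q : QuadraticForm k (Fin n → k)) : QuadraticForm k (Fin (n + 1) → k) :=
  a • QuadraticMap.sq.comp (LinearMap.proj 0) + q.comp (LinearMap.funLeft k k Fin.succ)

/-- The polynomial `ψ(x₁, …, xₙ)` attached to a quadratic form `ψ` on `kⁿ`. -/
def formPolynomial (ψ : QuadraticForm k (Fin n → k)) : MvPolynomial (Fin n) k :=
  ∑ i, MvPolynomial.C (ψ (Pi.single i 1)) * MvPolynomial.X i ^ 2 +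
    ∑ i, ∑ j ∈ Finset.Ioi i, MvPolynomial.C
      (QuadraticMap.polar ψ (Pi.single i 1) (Pi.single j 1)) * MvPolynomial.X i * MvPolynomial.X j

/-- The coordinate ring `k[x₁, …, xₙ]/(ψ(x₁, …, xₙ) - 1)` of the affine quadric `ψ = 1`. -/
abbrev CoordRing (ψ : QuadraticForm k (Fin n → k)) : Type u :=
  MvPolynomial (Fin n) k ⧸ Ideal.span {formPolynomial ψ - 1}

/-- The affine quadric `Q^ψ = {ψ = 1} ⊆ 𝔸ⁿ` as a `k`-scheme. -/
def quadric (ψ : QuadraticForm k (Fin n → k)) : Over (Spec (.of k)) :=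
  Over.mk (Spec.map (CommRingCat.ofHom (algebraMap k (CoordRing ψ))))

/-- The `F`-point of `Q^ψ` given by a `k`-algebra homomorphism `k[Q^ψ] → F`. -/
def toPoint {ψ : QuadraticForm k (Fin n → k)} {F : Type u} [Field F] [Algebra k F]
    (p : CoordRing ψ →ₐ[k] F) :
    Over.mk (Spec.map (CommRingCat.ofHom (algebraMap k F))) ⟶ quadric ψ :=
  Over.homMk (Spec.map (CommRingCat.ofHom p.toRingHom)) (by
    change Spec.map _ ≫ Spec.map _ = Spec.map _
    rw [← Spec.map_comp, ← CommRingCat.ofHom_comp]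
    congr 2
    exact p.comp_algebraMap)

/-- The form `φ_F` on `F ⊗ kⁿ` obtained from `φ` by extension of scalars, in characteristic `0`. -/
def extend [CharZero k] (φ : QuadraticForm k (Fin n → k)) (F : Type u) [Field F] [Algebra k F] :
    QuadraticForm F (F ⊗[k] (Fin n → k)) :=
  letI : Invertible (2 : k) := invertibleOfNonzero two_ne_zero
  φ.baseChange F

/-- The subgroup `⟨D(q)⟩` of `Fˣ` generated by the nonzero values of the quadratic form `q`. -/
def valueGroup {F V : Type*} [Field F] [AddCommGroup V] [Module F V] (q : QuadraticForm F V) :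
    Subgroup Fˣ :=
  Subgroup.closure {d | ∃ v, q v = d}

/-- The form `⟨1, -1⟩ ⊥ φ'`. -/
def psi (φ' : QuadraticForm k (Fin n → k)) : QuadraticForm k (Fin (n + 2) → k) :=
  consForm 1 (consForm (-1) φ')

/-- The form `⟨1⟩ ⊥ (-φ')`. -/
def phi (φ' : QuadraticForm k (Fin n → k)) : QuadraticForm k (Fin (n + 1) → k) :=
  consForm 1 (-φ')

/-- The function `x₁ = y₁ + y₂` on the quadric `y₁² - y₂² + φ'(y₃, …) = 1`. With
`x₂ = y₁ - y₂` and `φ = ⟨1⟩ ⊥ (-φ')`, the equation of the quadric becomes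
`x₁ x₂ = φ(1, y₃, …)`. -/
def x₁ (φ' : QuadraticForm k (Fin n → k)) : CoordRing (psi φ') :=
  Ideal.Quotient.mk _ (MvPolynomial.X 0 + MvPolynomial.X 1)

end AffineQuadric
end

/-!
The proof has a geometric half, which replaces the Nisnevich sheaf by an explicit set, and an
arithmetic half, which computes that set.

*Geometry.* In characteristic `0` a finitely generated field `F` has smooth models, and they form a
directed system in which every finite set of elements of `F`, hence every `F`-point of a scheme of
finite type, is eventually defined. A Nisnevich cover of `Spec A` splits at its generic point, so
the splitting extends over a larger model `B ⊇ A` and the inclusion `Spec B ⟶ Spec A` belongs to the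
cover (`exists_model_of_covering`). Sheafification therefore changes nothing over `Spec F`, and for
an affine `k`-scheme `X` of finite type `𝒮(X)(F)` is the set of `F`-points modulo the equivalence
relation generated by the `F[T]`-points (`exists_equiv_componentsAt`).

*Arithmetic.* Along an `F[T]`-point of the quadric, `x₁` is a polynomial dividing the value of `φ`
at the unimodular vector `(1, x₃(T), …)`. If `φ_F` is anisotropic, such a polynomial takes the same
value at `0` and `1` modulo `⟨D(φ_F)⟩` (`endsAgree_of_dvd_formVal`). This is an induction on the
degree as in Knebusch's norm principle: an irreducible `π` dividing a value of `φ` at a vector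
nonzero modulo `π` also divides a value at a unimodular vector of degree less than `deg π`, and the
quotient by `π` has degree less than `π` too. So `x₁` is a homotopy invariant.

Conversely points with the same nonzero `x₁`, or the same nonzero `x₂`, are joined by a line, and
passing from one coordinate to the other multiplies `x₁` by an arbitrary nonzero value `φ(1, x)`. As
`φ(s, t x) = s² + c t²` is a norm form, these values generate all squares, hence `⟨D(φ_F)⟩`
(`valueGroup_le_stableUnits`). If `φ_F` is isotropic, it vanishes at some `(1, x)`, and the line
`x₂ = 0` through that `x` links all points.
-/

noncomputable section

/-! ### Smooth models of a finitely generated field -/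

namespace NaiveA1

section models
variable {k F : Type u} [Field k] [Field F] [Algebra k F]

/-- If `A ⊆ F` has fraction field `F` and its localization at `s ≠ 0` is smooth, then `A[1/s]`,
taken inside `F`, is a smooth model. -/
lemma exists_smoothModel_of_away (A : Subalgebra k F) [IsFractionRing A F] (s : A)
    (hs : s ≠ 0) (hA : Algebra.Smooth k (Localization.Away s)) :
    ∃ B : SmoothModel k F, A ≤ B.1 ∧ (s : F)⁻¹ ∈ B.1 := by
  have hs0 : (s : F) ≠ 0 := fun h => hs (Subtype.ext h)
  have hu : IsUnit (algebraMap A F s) := isUnit_iff_ne_zero.mpr hs0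
  let φ : Localization.Away s →ₐ[A] F :=
    { IsLocalization.Away.lift s hu with
      commutes' := fun a => IsLocalization.Away.lift_eq s hu a }
  have hle' : Submonoid.powers s ≤ nonZeroDivisors A :=
    powers_le_nonZeroDivisors_of_noZeroDivisors hs
  have hφ : Function.Injective φ := by
    change Function.Injective (IsLocalization.Away.lift s hu)
    refine (IsLocalization.lift_injective_iff _).mpr fun x y => ?_
    rw [(IsLocalization.injective (Localization.Away s) hle').eq_iff,
      (IsFractionRing.injective A F).eq_iff]
  let ψ : Localization.Away s →ₐ[k] F := φ.restrictScalars k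
  let e : Localization.Away s ≃ₐ[k] ψ.range := AlgEquiv.ofInjective ψ hφ
  have hle : A ≤ ψ.range := fun a ha => ⟨algebraMap A _ ⟨a, ha⟩, φ.commutes ⟨a, ha⟩⟩
  refine ⟨⟨ψ.range, Algebra.Smooth.of_equiv e, ?_⟩, hle, ?_⟩
  · refine IsFractionRing.of_field _ _ fun z => ?_
    obtain ⟨x, y, -, rfl⟩ := IsFractionRing.div_surjective (A := A) z
    exact ⟨⟨x, hle x.2⟩, ⟨y, hle y.2⟩, rfl⟩
  · refine ⟨IsLocalization.Away.invSelf s, eq_inv_of_mul_eq_one_right ?_⟩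
    have h1 : ψ (algebraMap A _ s) = s := φ.commutes s
    have h2 := congrArg ψ (IsLocalization.Away.mul_invSelf (S := Localization.Away s) s)
    rw [map_mul, map_one] at h2
    rw [← h1]
    exact h2

lemma SmoothModel.exists_ge_mem (A : SmoothModel k F) (z : F) :
    ∃ B : SmoothModel k F, A ≤ B ∧ z ∈ B.1 := by
  have := A.2.1
  have := A.2.2
  obtain ⟨x, y, hy, rfl⟩ := IsFractionRing.div_surjective (A := A.1) z
  have : Algebra.Smooth A.1 (Localization.Away y) := Algebra.Smooth.of_isLocalization_Away y
  obtain ⟨B, hB, hyB⟩ := exists_smoothModel_of_away A.1 y (nonZeroDivisors.ne_zero hy)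
    (Algebra.Smooth.comp k A.1 _)
  refine ⟨B, hB, ?_⟩
  rw [div_eq_mul_inv]
  exact mul_mem (hB x.2) hyB

theorem SmoothModel.exists_ge (A : SmoothModel k F) (S : Set F) (hS : S.Finite) :
    ∃ B : SmoothModel k F, A ≤ B ∧ S ⊆ B.1 := by
  induction S, hS using Set.Finite.induction_on with
  | empty => exact ⟨A, le_rfl, Set.empty_subset _⟩
  | @insert a S _ _ ih =>
    obtain ⟨B, hAB, hSB⟩ := ih
    obtain ⟨C, hBC, haC⟩ := B.exists_ge_mem a
    exact ⟨C, hAB.trans hBC, Set.insert_subset haC (hSB.trans hBC)⟩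

/-- Finitely generated subalgebras of `F` are contained in arbitrarily large smooth models. -/
theorem SmoothModel.exists_ge_subalgebra (A : SmoothModel k F) (S : Subalgebra k F) (hS : S.FG) :
    ∃ B : SmoothModel k F, A ≤ B ∧ S ≤ B.1 := by
  obtain ⟨t, rfl⟩ := hS
  obtain ⟨B, hAB, hB⟩ := A.exists_ge t t.finite_toSet
  exact ⟨B, hAB, Algebra.adjoin_le hB⟩

instance : IsDirectedOrder (SmoothModel k F) where
  directed A B := by
    have := B.2.1
    have hB : B.1.FG := Subalgebra.fg_iff_finiteType B.1 |>.mpr inferInstance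
    obtain ⟨C, hAC, hBC⟩ := A.exists_ge_subalgebra B.1 hB
    exact ⟨C, hAC, hBC⟩

/-- Generic smoothness: in characteristic `0` a finitely generated field extension is the fraction
field of a smooth algebra, because it is formally smooth and the smooth locus is open. -/
theorem nonempty_smoothModel [CharZero k] (hF : (⊤ : IntermediateField k F).FG) :
    Nonempty (SmoothModel k F) := by
  have : Algebra.EssFiniteType k F := IntermediateField.fg_top_iff.mp hF
  let A : Subalgebra k F := Algebra.EssFiniteType.subalgebra k F
  have hA : Algebra.FiniteType k A := inferInstance
  have hfr : IsFractionRing A F := by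
    refine IsFractionRing.of_field _ _ fun z => ?_
    obtain ⟨x, s, rfl⟩ := IsLocalization.exists_mk'_eq (Algebra.EssFiniteType.submonoid k F) z
    have hs : s.1.1 ≠ 0 := (IsLocalization.map_units F s).ne_zero
    exact ⟨x, s, by simp [IsLocalization.mk'_eq_iff_eq_mul, hs]⟩
  have : Algebra.FinitePresentation k A := Algebra.FinitePresentation.of_finiteType.mp hA
  have hprime : (⊥ : Ideal A).IsPrime := Ideal.isPrime_bot
  have hloc : IsLocalization (⊥ : Ideal A).primeCompl F := by
    rw [Ideal.primeCompl_bot]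
    exact hfr
  have : Algebra.IsSmoothAt k (⊥ : Ideal A) :=
    Algebra.FormallySmooth.of_equiv (A := F)
      ((IsLocalization.algEquiv (⊥ : Ideal A).primeCompl F
        (Localization.AtPrime (⊥ : Ideal A))).restrictScalars k)
  obtain ⟨f, hf, hsm⟩ := Algebra.IsSmoothAt.exists_notMem_smooth k (⊥ : Ideal A)
  obtain ⟨B, -, -⟩ := exists_smoothModel_of_away A f hf hsm
  exact ⟨B⟩

end models

/-! ### Extending points to models, and Nisnevich covers -/

section spreading
variable {k F : Type u} [Field k] [Field F] [Algebra k F]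

/-- The generic point `Spec F ⟶ Spec A` of a subalgebra `A ⊆ F`. -/
def genericPoint (A : Subalgebra k F) : Spec (.of F) ⟶ Spec (.of A) :=
  Spec.map (CommRingCat.ofHom A.val.toRingHom)

lemma genericPoint_comp (A : Subalgebra k F) :
    genericPoint A ≫ Spec.map (CommRingCat.ofHom (algebraMap k A)) =
      Spec.map (CommRingCat.ofHom (algebraMap k F)) := by
  rw [genericPoint, ← Spec.map_comp]
  rfl

lemma genericPoint_inclusion {A B : Subalgebra k F} (h : A ≤ B) :
    genericPoint B ≫ Spec.map (CommRingCat.ofHom (Subalgebra.inclusion h).toRingHom) =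
      genericPoint A := by
  rw [genericPoint, ← Spec.map_comp]
  rfl

/-- A morphism from `Spec A` to an affine scheme is determined at the generic point. -/
lemma eq_of_genericPoint_comp_eq (A : Subalgebra k F) {R : CommRingCat.{u}}
    {f g : Spec (.of A) ⟶ Spec R} (h : genericPoint A ≫ f = genericPoint A ≫ g) : f = g := by
  obtain ⟨f, rfl⟩ := Spec.map_surjective f
  obtain ⟨g, rfl⟩ := Spec.map_surjective g
  rw [genericPoint, ← Spec.map_comp, ← Spec.map_comp] at h
  have h' := Spec.map_injective h
  congr 1
  ext x : 2
  exact Subtype.ext (congr($h' x))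

/-- An `F`-point of a `k`-scheme locally of finite type extends to some smooth model of `F`. -/
theorem exists_model_extend {Y : Scheme.{u}} (g : Y ⟶ Spec (.of k)) [LocallyOfFiniteType g]
    (s : Spec (.of F) ⟶ Y) (hs : s ≫ g = Spec.map (CommRingCat.ofHom (algebraMap k F)))
    (A : SmoothModel k F) :
    ∃ B : SmoothModel k F, A ≤ B ∧ ∃ t : Spec (.of B.1) ⟶ Y, genericPoint B.1 ≫ t = s ∧
      t ≫ g = Spec.map (CommRingCat.ofHom (algebraMap k B.1)) := by
  obtain ⟨R, i, hi, hy, -⟩ := Scheme.exists_affine_mem_range_and_range_subset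
    (TopologicalSpace.Opens.mem_top (s (IsLocalRing.closedPoint F)))
  have hrange : Set.range s ⊆ Set.range i := by
    rintro _ ⟨z, rfl⟩
    rwa [show z = IsLocalRing.closedPoint F from Subsingleton.elim (α := PrimeSpectrum F) _ _]
  obtain ⟨φ, hφ⟩ := Spec.map_surjective (IsOpenImmersion.lift i s hrange)
  obtain ⟨χ, hχ⟩ := Spec.map_surjective (i ≫ g)
  have hfin : χ.hom.FiniteType := by
    have : LocallyOfFiniteType (i ≫ g) := inferInstance
    rw [← hχ] at this
    exact (HasRingHomProperty.Spec_iff (P := @LocallyOfFiniteType)).mp this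
  have hφχ : χ ≫ φ = CommRingCat.ofHom (algebraMap k F) := by
    apply Spec.map_injective
    rw [Spec.map_comp, hφ, hχ, IsOpenImmersion.lift_fac_assoc, hs]
  let : Algebra k R := χ.hom.toAlgebra
  let ψ : R →ₐ[k] F := { φ.hom with commutes' := fun a => congr($hφχ a) }
  have hrg : ψ.range.FG := by
    have : Algebra.FiniteType k R := hfin
    rw [← Algebra.map_top]
    exact (Algebra.FiniteType.out (R := k) (A := R)).map ψ
  obtain ⟨B, hAB, hB⟩ := A.exists_ge_subalgebra ψ.range hrg
  let ψ' : R →ₐ[k] B.1 := ψ.codRestrict B.1 fun r => hB ⟨r, rfl⟩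
  have h1 : genericPoint B.1 ≫ Spec.map (CommRingCat.ofHom ψ'.toRingHom) = Spec.map φ := by
    rw [genericPoint, ← Spec.map_comp]
    rfl
  refine ⟨B, hAB, Spec.map (CommRingCat.ofHom ψ'.toRingHom) ≫ i, ?_, ?_⟩
  · rw [reassoc_of% h1, hφ, IsOpenImmersion.lift_fac]
  · rw [Category.assoc, ← hχ, ← Spec.map_comp]
    congr 1
    ext a : 2
    exact ψ'.commutes a

/-- Nisnevich covers split generically: a morphism of a covering sieve is dominated by
an inclusion of models. -/
theorem exists_model_of_covering (A : SmoothModel k F) {R : Sieve A.spec}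
    (hR : R ∈ nisnevichTopology k A.spec) :
    ∃ (B : SmoothModel k F) (h : A ⟶ B), R ((modelFunctor k F).map h).unop := by
  let η : Spec (.of F) ⟶ A.spec.left := genericPoint A.1
  -- At the image `x` of the generic point, the lift of `κ(x)` composed with `κ(x) → F` is an
  -- `F`-point of the covering scheme, which extends to a model.
  obtain ⟨⟨x, ι⟩, hx⟩ := (Scheme.SpecToEquivOfField F A.spec.left).symm.surjective η
  replace hx : Spec.map ι ≫ A.spec.left.fromSpecResidueField x = η := hx
  obtain ⟨Y, f, hf, -, hfx⟩ := hR x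
  rw [splitsAt_iff_exists_lift] at hfx
  obtain ⟨t, ht⟩ := hfx
  obtain ⟨B, hAB, r, hr, hr'⟩ := exists_model_extend (F := F) Y.hom (Spec.map ι ≫ t) (by
    rw [← MorphismProperty.Over.w f, Category.assoc, reassoc_of% ht, reassoc_of% hx]
    exact genericPoint_comp A.1) A
  refine ⟨B, homOfLE hAB, ?_⟩
  let q : B.spec ⟶ Y := MorphismProperty.Over.homMk r hr'
  have : ((modelFunctor k F).map (homOfLE hAB)).unop = q ≫ f := by
    ext1
    change Spec.map (CommRingCat.ofHom (Subalgebra.inclusion hAB).toRingHom) = r ≫ f.left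
    refine eq_of_genericPoint_comp_eq B.1 ?_
    rw [genericPoint_inclusion]
    have h2 : (genericPoint B.1 ≫ r) ≫ f.left = η := by
      rw [hr, Category.assoc, ht, hx]
    rw [Category.assoc] at h2
    exact h2.symm
  rw [this]
  exact R.downward_closed hf q

end spreading

/-! ### Germs of naive connected components -/

section germs
variable {k F : Type u} [Field k] [Field F] [Algebra k F]

lemma germ_map (P : (Sm k)ᵒᵖ ⥤ Type (u + 1)) {A B : SmoothModel k F} (h : A ⟶ B)
    (s : P.obj (op A.spec)) : germ P B (P.map ((modelFunctor k F).map h) s) = germ P A s :=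
  congr($(colimit.w (modelFunctor k F ⋙ P) h) s)

lemma exists_germ_eq (P : (Sm k)ᵒᵖ ⥤ Type (u + 1)) (s : fieldSections P F) :
    ∃ (A : SmoothModel k F) (t : P.obj (op A.spec)), germ P A t = s :=
  Types.jointly_surjective_of_isColimit (colimit.isColimit (modelFunctor k F ⋙ P)) s

lemma germ_eq_iff (P : (Sm k)ᵒᵖ ⥤ Type (u + 1)) {A B : SmoothModel k F}
    (s : P.obj (op A.spec)) (t : P.obj (op B.spec)) :
    germ P A s = germ P B t ↔ ∃ (C : SmoothModel k F) (f : A ⟶ C) (g : B ⟶ C),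
      P.map ((modelFunctor k F).map f) s = P.map ((modelFunctor k F).map g) t := by
  have : Nonempty (SmoothModel k F) := ⟨A⟩
  exact Types.FilteredColimit.colimit_eq_iff (modelFunctor k F ⋙ P)

/-- Every section of the sheaf of naive components over `Spec F` is represented by a section of
the presheaf over a smooth model. -/
theorem exists_germ_toNaiveComponents (P : (Sm k)ᵒᵖ ⥤ Type (u + 1))
    (s : fieldSections (naiveComponents P).obj F) :
    ∃ (A : SmoothModel k F) (t : P.obj (op A.spec)),
      s = germ _ A ((toNaiveComponents P).app (op A.spec) t) := by
  obtain ⟨A, s, rfl⟩ := exists_germ_eq _ s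
  obtain ⟨B, h, t, ht⟩ := exists_model_of_covering A
    (Presheaf.imageSieve_mem (nisnevichTopology k)
      (CategoryTheory.toSheafify (nisnevichTopology k) (naivePre P)) s)
  obtain ⟨t, rfl⟩ := Quot.exists_rep t
  refine ⟨B, t, ?_⟩
  rw [← germ_map _ h]
  exact congrArg _ ht.symm

/-- Two sections over smooth models represent the same element over `Spec F` only if they become
chain homotopic over a larger model. -/
theorem exists_eqvGen_of_germ_eq (P : (Sm k)ᵒᵖ ⥤ Type (u + 1)) {A B : SmoothModel k F}
    (s : P.obj (op A.spec)) (t : P.obj (op B.spec))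
    (h : germ _ A ((toNaiveComponents P).app (op A.spec) s) =
      germ _ B ((toNaiveComponents P).app (op B.spec) t)) :
    ∃ (C : SmoothModel k F) (f : A ⟶ C) (g : B ⟶ C),
      Relation.EqvGen (Homotopic P C.spec)
        (P.map ((modelFunctor k F).map f) s) (P.map ((modelFunctor k F).map g) t) := by
  obtain ⟨C, f, g, hfg⟩ := (germ_eq_iff _ _ _).mp h
  have hC : (CategoryTheory.toSheafify (nisnevichTopology k) (naivePre P)).app (op C.spec)
      (Quot.mk _ (P.map ((modelFunctor k F).map f) s)) =
      (CategoryTheory.toSheafify (nisnevichTopology k) (naivePre P)).app (op C.spec)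
      (Quot.mk _ (P.map ((modelFunctor k F).map g) t)) := by
    have h1 := congr($((toNaiveComponents P).naturality ((modelFunctor k F).map f)) s)
    have h2 := congr($((toNaiveComponents P).naturality ((modelFunctor k F).map g)) t)
    exact h1.trans (hfg.trans h2.symm)
  obtain ⟨D, d, hd⟩ := exists_model_of_covering C
    (Presheaf.equalizerSieve_mem (nisnevichTopology k)
      (CategoryTheory.toSheafify (nisnevichTopology k) (naivePre P)) _ _ hC)
  refine ⟨D, f ≫ d, g ≫ d, ?_⟩
  have h1 := congr($((modelFunctor k F ⋙ P).map_comp f d) s)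
  have h2 := congr($((modelFunctor k F ⋙ P).map_comp g d) t)
  have h3 := Quot.eqvGen_exact hd
  exact (congrArg₂ (Relation.EqvGen (Homotopic P D.spec)) h1 h2).mpr h3

lemma toNaiveComponents_eq_of_homotopic (P : (Sm k)ᵒᵖ ⥤ Type (u + 1)) {X : Sm k}
    {s t : P.obj (op X)} (h : Homotopic P X s t) :
    (toNaiveComponents P).app (op X) s = (toNaiveComponents P).app (op X) t :=
  congrArg ((CategoryTheory.toSheafify (nisnevichTopology k) (naivePre P)).app (op X))
    (Quot.sound h)

lemma germ_toNaiveComponents_map (P : (Sm k)ᵒᵖ ⥤ Type (u + 1)) {A B : SmoothModel k F}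
    (h : A ⟶ B) (s : P.obj (op A.spec)) :
    germ _ B ((toNaiveComponents P).app (op B.spec) (P.map ((modelFunctor k F).map h) s)) =
      germ _ A ((toNaiveComponents P).app (op A.spec) s) := by
  rw [← germ_map _ h]
  exact congrArg _ congr($((toNaiveComponents P).naturality ((modelFunctor k F).map h)) s)

end germs

/-! ### Points of affine schemes and their homotopies -/

section points
variable {k : Type u} [Field k] {C R : Type u} [CommRing C] [Algebra k C] [CommRing R] [Algebra k R]

variable (k R) in
/-- The `k`-scheme `Spec R`. -/
abbrev specOver : Over (Spec (.of k)) :=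
  Over.mk (Spec.map (CommRingCat.ofHom (algebraMap k R)))

/-- Morphisms `Spec R ⟶ Spec C` over `k` are `k`-algebra homomorphisms `C → R`. -/
def specHomEquiv : (C →ₐ[k] R) ≃ (specOver k R ⟶ specOver k C) where
  toFun p := Over.homMk (Spec.map (CommRingCat.ofHom p.toRingHom)) (by
    change Spec.map _ ≫ Spec.map _ = Spec.map _
    rw [← Spec.map_comp, ← CommRingCat.ofHom_comp]
    congr 2
    exact p.comp_algebraMap)
  invFun f :=
    { (Spec.preimage f.left).hom with
      commutes' := fun a => by
        have h := Over.w f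
        change f.left ≫ Spec.map _ = Spec.map _ at h
        rw [← Spec.map_preimage f.left, ← Spec.map_comp] at h
        exact congr($(Spec.map_injective h) a) }
  left_inv p := by
    ext c
    change (Spec.preimage (Spec.map (CommRingCat.ofHom p.toRingHom))).hom c = _
    rw [Spec.preimage_map]
    rfl
  right_inv f := by
    ext1
    exact Spec.map_preimage f.left

lemma specHomEquiv_left (p : C →ₐ[k] R) :
    (specHomEquiv p).left = Spec.map (CommRingCat.ofHom p.toRingHom) := rfl

/-- Two `R`-points of `Spec C` are directly homotopic if they are the values at `0` and `1` of an
`R[X]`-point. -/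
def PointHomotopic (p q : C →ₐ[k] R) : Prop :=
  ∃ h : C →ₐ[k] Polynomial R, ∀ c, (h c).eval 0 = p c ∧ (h c).eval 1 = q c

/-- The section of `𝔸¹_R ⟶ Spec R` with coordinate `a` corresponds to evaluation at `a`. -/
lemma homOfVector_id_eq (R : CommRingCat.{u}) (a : R) :
    AffineSpace.homOfVector (n := PUnit.{u + 1}) (𝟙 (Spec R))
        (fun _ => (Scheme.ΓSpecIso R).inv a) =
      Spec.map (CommRingCat.ofHom
        (MvPolynomial.aeval (R := R) (fun _ : PUnit.{u + 1} => a)).toRingHom) ≫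
        (AffineSpace.SpecIso PUnit.{u + 1} R).inv := by
  apply AffineSpace.hom_ext
  · rw [AffineSpace.homOfVector_over, Category.assoc, AffineSpace.SpecIso_inv_over,
      ← Spec.map_comp, ← Spec.map_id]
    congr 1
    ext x
    simp
  · intro i
    rw [AffineSpace.homOfVector_appTop_coord, Scheme.Hom.comp_appTop, CommRingCat.comp_apply]
    conv_rhs => enter [2]; tactic => exact AffineSpace.SpecIso_inv_appTop_coord _ _
    rw [← CommRingCat.comp_apply, ← Scheme.ΓSpecIso_inv_naturality, CommRingCat.comp_apply]
    congr 1
    simp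

end points

section
variable {k F : Type u} [Field k] [Field F] [Algebra k F] {C : Type u} [CommRing C] [Algebra k C]

lemma zeroSection_left (A : SmoothModel k F) :
    (zeroSection A.spec).left = Spec.map (CommRingCat.ofHom
        (MvPolynomial.aeval (R := A.1) (fun _ : PUnit.{u + 1} => 0)).toRingHom) ≫
        (AffineSpace.SpecIso PUnit.{u + 1} (.of A.1)).inv := by
  refine Eq.trans ?_ (homOfVector_id_eq (.of A.1) 0)
  rw [map_zero]
  rfl

lemma oneSection_left (A : SmoothModel k F) :
    (oneSection A.spec).left = Spec.map (CommRingCat.ofHom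
        (MvPolynomial.aeval (R := A.1) (fun _ : PUnit.{u + 1} => 1)).toRingHom) ≫
        (AffineSpace.SpecIso PUnit.{u + 1} (.of A.1)).inv := by
  refine Eq.trans ?_ (homOfVector_id_eq (.of A.1) 1)
  rw [map_one]
  rfl

/-- The section of the functor of points of `Spec C` over a model `A` given by `C → A`. -/
def modelPoint (A : SmoothModel k F) (p : C →ₐ[k] A.1) :
    (pointFunctor (specOver k C)).obj (op A.spec) :=
  ULift.up (specHomEquiv p)

lemma exists_modelPoint_eq (A : SmoothModel k F)
    (f : (pointFunctor (specOver k C)).obj (op A.spec)) : ∃ p, f = modelPoint A p :=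
  ⟨specHomEquiv.symm f.down, ULift.ext _ _ (specHomEquiv.apply_symm_apply f.down).symm⟩

lemma map_modelPoint {A B : SmoothModel k F} (h : A ⟶ B) (p : C →ₐ[k] A.1) :
    (pointFunctor (specOver k C)).map ((modelFunctor k F).map h) (modelPoint A p) =
      modelPoint B ((Subalgebra.inclusion (leOfHom h)).comp p) := by
  apply ULift.ext
  apply Over.OverMorphism.ext
  change Spec.map _ ≫ Spec.map _ = Spec.map _
  rw [← Spec.map_comp]
  rfl

/-- Through the isomorphism `𝔸¹_A ≅ Spec A[X]`, homotopies of `A`-points of an affine scheme are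
`A[X]`-points. -/
theorem homotopic_modelPoint_iff (A : SmoothModel k F) (p q : C →ₐ[k] A.1) :
    Homotopic (pointFunctor (specOver k C)) A.spec (modelPoint A p) (modelPoint A q) ↔
      PointHomotopic p q := by
  let ι := AffineSpace.SpecIso PUnit.{u + 1} (.of A.1)
  constructor
  · rintro ⟨⟨h⟩, h0, h1⟩
    let hl : 𝔸(PUnit.{u + 1}; Spec (.of A.1)) ⟶ Spec (.of C) := h.left
    obtain ⟨c, hc⟩ := Spec.map_surjective (ι.inv ≫ hl)
    have hck : CommRingCat.ofHom (algebraMap k C) ≫ c =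
        CommRingCat.ofHom (algebraMap k A.1) ≫ CommRingCat.ofHom MvPolynomial.C := by
      apply Spec.map_injective
      have hι := AffineSpace.SpecIso_inv_over (n := PUnit.{u + 1}) (.of A.1)
      have hw : hl ≫ Spec.map (CommRingCat.ofHom (algebraMap k C)) =
          (𝔸(PUnit.{u + 1}; Spec (.of A.1)) ↘ Spec (.of A.1)) ≫
            Spec.map (CommRingCat.ofHom (algebraMap k A.1)) := Over.w h
      rw [Spec.map_comp, hc, Spec.map_comp, Category.assoc, hw, ← Category.assoc]
      exact congrArg (· ≫ _) hι
    let cA : C →ₐ[k] MvPolynomial PUnit.{u + 1} A.1 :=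
      { c.hom with commutes' := fun a => congr($hck a) }
    have key (a : A.1) (r : C →ₐ[k] A.1) (hr : (Spec.map (CommRingCat.ofHom
        (MvPolynomial.aeval (R := A.1) (fun _ : PUnit.{u + 1} => a)).toRingHom) ≫
        ι.inv) ≫ hl = Spec.map (CommRingCat.ofHom r.toRingHom)) (x : C) :
        ((MvPolynomial.aeval fun _ => (Polynomial.X : Polynomial A.1)) (cA x)).eval a = r x := by
      rw [Category.assoc, ← hc, ← Spec.map_comp] at hr
      have := congr($(Spec.map_injective hr) x)
      refine Eq.trans ?_ this
      change _ = MvPolynomial.aeval (fun _ => a) (cA x)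
      generalize cA x = y
      induction y using MvPolynomial.induction_on with
      | C b => simp
      | add f g hf hg => simp [hf, hg]
      | mul_X f i hf => simp [hf]
    refine ⟨((MvPolynomial.aeval fun _ => (Polynomial.X : Polynomial A.1)).restrictScalars k).comp
      cA, fun x => ⟨key 0 p ?_ x, key 1 q ?_ x⟩⟩
    · rw [← zeroSection_left]
      exact congr($(h0).down.left)
    · rw [← oneSection_left]
      exact congr($(h1).down.left)
  · rintro ⟨c, hc⟩
    let d : C →ₐ[k] MvPolynomial PUnit.{u + 1} A.1 :=
      ((Polynomial.aeval (MvPolynomial.X (R := A.1) PUnit.unit)).restrictScalars k).comp c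
    have hw : (ι.hom ≫ Spec.map (CommRingCat.ofHom d.toRingHom)) ≫
        Spec.map (CommRingCat.ofHom (algebraMap k C)) =
        (𝔸(PUnit.{u + 1}; Spec (.of A.1)) ↘ Spec (.of A.1)) ≫
          Spec.map (CommRingCat.ofHom (algebraMap k A.1)) := by
      rw [← cancel_epi ι.inv, AffineSpace.SpecIso_inv_over_assoc, Category.assoc,
        Iso.inv_hom_id_assoc, ← Spec.map_comp, ← Spec.map_comp]
      congr 1
      ext a : 2
      exact d.commutes a
    have key (a : A.1) (r : C →ₐ[k] A.1) (hr : ∀ x, (c x).eval a = r x) :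
        (Spec.map (CommRingCat.ofHom
        (MvPolynomial.aeval (R := A.1) (fun _ : PUnit.{u + 1} => a)).toRingHom) ≫
        ι.inv) ≫ ι.hom ≫ Spec.map (CommRingCat.ofHom d.toRingHom) =
          Spec.map (CommRingCat.ofHom r.toRingHom) := by
      rw [Category.assoc, Iso.inv_hom_id_assoc, ← Spec.map_comp]
      congr 1
      ext x : 2
      refine Eq.trans ?_ (hr x)
      change MvPolynomial.aeval (fun _ => a)
        (Polynomial.aeval (MvPolynomial.X PUnit.unit) (c x)) = _
      rw [← Polynomial.aeval_algHom_apply, MvPolynomial.aeval_X, Polynomial.coe_aeval_eq_eval]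
    refine ⟨ULift.up (Over.homMk (ι.hom ≫ Spec.map (CommRingCat.ofHom d.toRingHom)) hw), ?_, ?_⟩
    · apply ULift.ext
      apply Over.OverMorphism.ext
      refine Eq.trans ?_ (key 0 p fun x => (hc x).1)
      rw [← zeroSection_left]
      rfl
    · apply ULift.ext
      apply Over.OverMorphism.ext
      refine Eq.trans ?_ (key 1 q fun x => (hc x).2)
      rw [← oneSection_left]
      rfl

end

/-! ### Naive components of an affine scheme over a field -/

section
variable {k F : Type u} [Field k] [Field F] [Algebra k F] {C : Type u} [CommRing C] [Algebra k C]

lemma isClassOf_iff (p : C →ₐ[k] F) (s : componentsAt (specOver k C) F) :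
    IsClassOf (specOver k C) (specHomEquiv p) s ↔
      ∃ (A : SmoothModel k F) (f : C →ₐ[k] A.1), A.1.val.comp f = p ∧
        s = germ _ A
          ((toNaiveComponents (pointFunctor (specOver k C))).app _ (modelPoint A f)) := by
  constructor
  · rintro ⟨A, f, hf, rfl⟩
    obtain ⟨f, rfl⟩ := specHomEquiv.surjective f
    refine ⟨A, f, ?_, rfl⟩
    apply specHomEquiv.injective
    apply Over.OverMorphism.ext
    rw [← hf, specHomEquiv_left, specHomEquiv_left, ← Spec.map_comp]
    rfl
  · rintro ⟨A, f, rfl, rfl⟩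
    refine ⟨A, specHomEquiv f, ?_, rfl⟩
    rw [specHomEquiv_left, specHomEquiv_left, ← Spec.map_comp]
    rfl

lemma exists_isClassOf_of_section (s : componentsAt (specOver k C) F) :
    ∃ p : C →ₐ[k] F, IsClassOf (specOver k C) (specHomEquiv p) s := by
  obtain ⟨A, f, rfl⟩ := exists_germ_toNaiveComponents _ s
  obtain ⟨f, rfl⟩ := exists_modelPoint_eq A f
  exact ⟨A.1.val.comp f, (isClassOf_iff _ _).mpr ⟨A, f, rfl, rfl⟩⟩

lemma PointHomotopic.map {R S : Type u} [CommRing R] [Algebra k R] [CommRing S] [Algebra k S]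
    {p q : C →ₐ[k] R} (h : PointHomotopic p q) (f : R →ₐ[k] S) :
    PointHomotopic (f.comp p) (f.comp q) := by
  obtain ⟨h, hh⟩ := h
  refine ⟨(Polynomial.mapAlgHom f).comp h, fun c => ⟨?_, ?_⟩⟩
  · simp [(hh c).1]
  · simp [(hh c).2]

/-- Points with a common class are chain homotopic over `F`. -/
lemma eqvGen_of_isClassOf {p q : C →ₐ[k] F} {s : componentsAt (specOver k C) F}
    (hp : IsClassOf (specOver k C) (specHomEquiv p) s)
    (hq : IsClassOf (specOver k C) (specHomEquiv q) s) :
    Relation.EqvGen PointHomotopic p q := by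
  obtain ⟨A, f, rfl, rfl⟩ := (isClassOf_iff _ _).mp hp
  obtain ⟨B, g, rfl, h⟩ := (isClassOf_iff _ _).mp hq
  obtain ⟨D, a, b, hD⟩ := exists_eqvGen_of_germ_eq _ _ _ h
  rw [map_modelPoint, map_modelPoint] at hD
  have key : ∀ x y, Relation.EqvGen (Homotopic (pointFunctor (specOver k C)) D.spec) x y →
      ∀ p q, x = modelPoint D p → y = modelPoint D q →
        Relation.EqvGen PointHomotopic (D.1.val.comp p) (D.1.val.comp q) := by
    have hinj : Function.Injective (modelPoint (C := C) D) := fun p q h =>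
      specHomEquiv.injective (congrArg ULift.down h)
    intro x y h
    induction h with
    | rel x y h =>
      rintro p q rfl rfl
      exact .rel _ _ (((homotopic_modelPoint_iff D p q).mp h).map _)
    | refl x =>
      intro p q hp hq
      rw [hinj (hp.symm.trans hq)]
      exact .refl _
    | symm x y _ ih => exact fun p q hp hq => (ih q p hq hp).symm
    | trans x y z _ _ ih₁ ih₂ =>
      intro p q hp hq
      obtain ⟨r, hr⟩ := exists_modelPoint_eq D y
      exact (ih₁ p r hp hr).trans _ _ _ (ih₂ r q hr hq)
  exact key _ _ hD _ _ rfl rfl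

/-- Two extensions of an `F`-point to models agree on any common larger model. -/
lemma isClassOf_unique {p : C →ₐ[k] F} {s t : componentsAt (specOver k C) F}
    (hs : IsClassOf (specOver k C) (specHomEquiv p) s)
    (ht : IsClassOf (specOver k C) (specHomEquiv p) t) : s = t := by
  obtain ⟨A, f, rfl, rfl⟩ := (isClassOf_iff _ _).mp hs
  obtain ⟨B, g, hg, rfl⟩ := (isClassOf_iff _ _).mp ht
  obtain ⟨D, hA, hB⟩ := exists_ge_ge A B
  rw [← germ_toNaiveComponents_map _ (homOfLE hA), ← germ_toNaiveComponents_map _ (homOfLE hB),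
    map_modelPoint, map_modelPoint]
  congr 3
  ext c
  exact congr($hg.symm c)

/-- A morphism from a finitely generated algebra to `F[X]` has coefficients in a smooth model. -/
lemma exists_model_polynomial [Algebra.FiniteType k C] (A : SmoothModel k F)
    (h : C →ₐ[k] Polynomial F) :
    ∃ (B : SmoothModel k F) (g : C →ₐ[k] Polynomial B.1),
      (Polynomial.mapAlgHom B.1.val).comp g = h := by
  obtain ⟨t, ht⟩ := Algebra.FiniteType.out (R := k) (A := C)
  obtain ⟨B, -, hB⟩ := A.exists_ge (⋃ c ∈ t, (h c).coeffs)
    (t.finite_toSet.biUnion fun c _ => (h c).coeffs.finite_toSet)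
  let ι : Polynomial B.1 →ₐ[k] Polynomial F := Polynomial.mapAlgHom B.1.val
  have hι : Function.Injective ι := Polynomial.map_injective _ Subtype.val_injective
  have hrange : h.range ≤ ι.range := by
    rw [← Algebra.map_top, ← ht, AlgHom.map_adjoin]
    refine Algebra.adjoin_le ?_
    rintro _ ⟨c, hc, rfl⟩
    have hlift : h c ∈ Polynomial.lifts B.1.val.toRingHom := by
      rw [Polynomial.lifts_iff_coeff_lifts]
      intro n
      by_cases h0 : (h c).coeff n = 0
      · exact ⟨0, by simp [h0]⟩
      · exact ⟨⟨_, hB (Set.mem_biUnion hc (Polynomial.coeff_mem_coeffs h0))⟩, rfl⟩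
    obtain ⟨P, hP⟩ := (Polynomial.mem_lifts _).mp hlift
    exact ⟨P, hP⟩
  refine ⟨B, (AlgEquiv.ofInjective ι hι).symm.toAlgHom.comp
    (h.codRestrict ι.range fun c => hrange ⟨c, rfl⟩), ?_⟩
  ext1 c
  have := (AlgEquiv.ofInjective ι hι).apply_symm_apply ⟨h c, hrange ⟨c, rfl⟩⟩
  exact congrArg Subtype.val this

lemma exists_isClassOf_of_pointHomotopic [Nonempty (SmoothModel k F)] [Algebra.FiniteType k C]
    {p q : C →ₐ[k] F} (h : PointHomotopic p q) :
    ∃ s, IsClassOf (specOver k C) (specHomEquiv p) s ∧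
      IsClassOf (specOver k C) (specHomEquiv q) s := by
  obtain ⟨h, hh⟩ := h
  obtain ⟨A, g, rfl⟩ := exists_model_polynomial (Classical.arbitrary _) h
  let ev (a : A.1) : C →ₐ[k] A.1 := ((Polynomial.aeval a).restrictScalars k).comp g
  have hev (a : A.1) (c : C) : ((Polynomial.mapAlgHom A.1.val).comp g c).eval (a : F) =
      ev a c := by
    change ((g c).map A.1.val.toRingHom).eval (A.1.val.toRingHom a) = _
    rw [Polynomial.eval_map_apply]
    rfl
  refine ⟨germ _ A ((toNaiveComponents (pointFunctor (specOver k C))).app _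
    (modelPoint A (ev 0))), (isClassOf_iff _ _).mpr ⟨A, ev 0, ?_, rfl⟩,
    (isClassOf_iff _ _).mpr ⟨A, ev 1, ?_, ?_⟩⟩
  · ext c
    exact (hev 0 c).symm.trans (hh c).1
  · ext c
    exact (hev 1 c).symm.trans (hh c).2
  · refine congrArg _ (toNaiveComponents_eq_of_homotopic _ ?_)
    rw [homotopic_modelPoint_iff]
    exact ⟨g, fun c => ⟨rfl, rfl⟩⟩

/-- For an affine `k`-scheme of finite type, the sheaf of naive connected components has as
sections over `Spec F` the naive homotopy classes of its `F`-points. -/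
theorem exists_equiv_componentsAt [Nonempty (SmoothModel k F)] [Algebra.FiniteType k C] :
    ∃ e : componentsAt (specOver k C) F ≃ Quot (PointHomotopic (C := C) (R := F) (k := k)),
      ∀ p s, IsClassOf (specOver k C) (specHomEquiv p) s ↔ e s = Quot.mk _ p := by
  have hex (p : C →ₐ[k] F) : ∃ s, IsClassOf (specOver k C) (specHomEquiv p) s :=
    have h : PointHomotopic p p :=
      ⟨(Polynomial.CAlgHom).comp p, fun c => by simp [Polynomial.CAlgHom]⟩
    let ⟨s, hs, _⟩ := exists_isClassOf_of_pointHomotopic h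
    ⟨s, hs⟩
  choose cls hcls using hex
  let e : Quot (PointHomotopic (C := C) (R := F) (k := k)) → componentsAt (specOver k C) F :=
    Quot.lift cls fun p q h => by
      obtain ⟨s, hp, hq⟩ := exists_isClassOf_of_pointHomotopic h
      rw [isClassOf_unique (hcls p) hp, isClassOf_unique (hcls q) hq]
  have he : Function.Bijective e := by
    constructor
    · rintro ⟨p⟩ ⟨q⟩ h
      have hp := hcls p
      have h' : cls p = cls q := h
      rw [h'] at hp
      exact Quot.eqvGen_sound (eqvGen_of_isClassOf hp (hcls q))
    · intro s
      obtain ⟨p, hp⟩ := exists_isClassOf_of_section s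
      exact ⟨Quot.mk _ p, isClassOf_unique (hcls p) hp⟩
  refine ⟨(Equiv.ofBijective e he).symm, fun p s => ?_⟩
  rw [Equiv.symm_apply_eq]
  change _ ↔ s = cls p
  exact ⟨fun h => isClassOf_unique h (hcls p), fun h => h ▸ hcls p⟩

end
end NaiveA1

/-! ### Values of quadratic forms -/

namespace AffineQuadric
open NaiveA1

section
variable {k : Type u} [Field k] {n : ℕ}

/-- The value `q(v)` of a quadratic form `q` over `k` at a vector `v` with entries in a
`k`-algebra. -/
def formVal (q : QuadraticForm k (Fin n → k)) {R : Type*} [CommRing R] [Algebra k R]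
    (v : Fin n → R) : R :=
  MvPolynomial.aeval v (formPolynomial q)

variable (q : QuadraticForm k (Fin n → k)) {R S : Type*} [CommRing R] [Algebra k R]
  [CommRing S] [Algebra k S]

lemma formVal_eq (v : Fin n → R) : formVal q v =
    ∑ i, algebraMap k R (q (Pi.single i 1)) * v i ^ 2 +
      ∑ i, ∑ j ∈ Finset.Ioi i, algebraMap k R
        (QuadraticMap.polar q (Pi.single i 1) (Pi.single j 1)) * v i * v j := by
  simp [formVal, formPolynomial]

lemma map_formVal (f : R →ₐ[k] S) (v : Fin n → R) :
    f (formVal q v) = formVal q fun i => f (v i) := by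
  simp [formVal_eq]

lemma formVal_smul (c : R) (v : Fin n → R) :
    formVal q (fun i => c * v i) = c ^ 2 * formVal q v := by
  simp only [formVal_eq, mul_add, Finset.mul_sum]
  congr 1
  · exact Finset.sum_congr rfl fun i _ => by ring
  · exact Finset.sum_congr rfl fun i _ => Finset.sum_congr rfl fun j _ => by ring

lemma formVal_zero : formVal q (0 : Fin n → R) = 0 := by
  simp [formVal_eq]

lemma formVal_neg (v : Fin n → R) : formVal (-q) v = -formVal q v := by
  simp [formVal_eq, QuadraticMap.polar_neg, add_comm]

lemma formVal_consForm (a : k) (v : Fin (n + 1) → R) :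
    formVal (consForm a q) v = algebraMap k R a * v 0 ^ 2 + formVal q (fun i => v i.succ) := by
  have h0 : (fun i : Fin n =>
      (Pi.single (0 : Fin (n + 1)) (1 : k) : Fin (n + 1) → k) i.succ) = 0 := by
    ext i; simp
  have hs (j : Fin n) : (fun i : Fin n => (Pi.single j.succ (1 : k) : Fin (n + 1) → k) i.succ) =
      Pi.single j 1 := by
    ext i; simp [Pi.single_apply]
  have e (x : Fin (n + 1) → k) : consForm a q x = a * (x 0 * x 0) + q (fun i => x i.succ) := rfl
  have p (x y : Fin (n + 1) → k) : QuadraticMap.polar (consForm a q) x y =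
      a * (2 * (x 0 * y 0)) + QuadraticMap.polar q (fun i => x i.succ) (fun i => y i.succ) := by
    simp only [QuadraticMap.polar, e, Pi.add_apply]
    have : (fun i : Fin n => x i.succ + y i.succ) =
      (fun i => x i.succ) + (fun i => y i.succ) := rfl
    rw [this]
    ring
  simp only [formVal_eq, Fin.sum_univ_succ, Fin.sum_Ioi_zero, Fin.sum_Ioi_succ, e, p, h0, hs]
  simp [add_assoc]

lemma natDegree_formVal_le {K : Type*} [Field K] [Algebra k K] (v : Fin n → Polynomial K) (d : ℕ)
    (hv : ∀ i, (v i).natDegree ≤ d) : (formVal q v).natDegree ≤ 2 * d := by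
  rw [formVal_eq]
  have hC (a : k) : (algebraMap k (Polynomial K) a).natDegree = 0 := by
    rw [Polynomial.algebraMap_apply, Polynomial.natDegree_C]
  refine Polynomial.natDegree_add_le_of_degree_le ?_ ?_
  · refine Polynomial.natDegree_sum_le_of_forall_le _ _ fun i _ => ?_
    refine Polynomial.natDegree_mul_le.trans ?_
    rw [hC, zero_add]
    refine Polynomial.natDegree_pow_le.trans ?_
    have := hv i
    omega
  · refine Polynomial.natDegree_sum_le_of_forall_le _ _ fun i _ =>
      Polynomial.natDegree_sum_le_of_forall_le _ _ fun j _ => ?_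
    refine Polynomial.natDegree_mul_le.trans ?_
    have := Polynomial.natDegree_mul_le (p := algebraMap k (Polynomial K)
      (QuadraticMap.polar q (Pi.single i 1) (Pi.single j 1))) (q := v i)
    have h1 := hv i
    have h2 := hv j
    rw [hC] at this
    omega

lemma dvd_formVal_sub {d : R} {v w : Fin n → R} (h : ∀ i, d ∣ v i - w i) :
    d ∣ formVal q v - formVal q w := by
  rw [← Ideal.mem_span_singleton, ← Ideal.Quotient.mk_eq_mk_iff_sub_mem]
  change Ideal.Quotient.mkₐ k _ _ = Ideal.Quotient.mkₐ k _ _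
  rw [map_formVal, map_formVal]
  congr 1
  ext i
  exact (Ideal.Quotient.mk_eq_mk_iff_sub_mem _ _).mpr (Ideal.mem_span_singleton.mpr (h i))

/-- A quadratic form is the sum of its diagonal and mixed terms in any family of coordinates. -/
lemma map_sum_smul_eq {A M : Type*} [CommRing A] [AddCommGroup M] [Module A M]
    (Q : QuadraticForm A M) {n : ℕ} (b : Fin n → M) (v : Fin n → A) :
    Q (∑ i, v i • b i) = ∑ i, Q (b i) * v i ^ 2 +
      ∑ i, ∑ j ∈ Finset.Ioi i, QuadraticMap.polar Q (b i) (b j) * v i * v j := by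
  induction n with
  | zero => simp
  | succ n ih =>
    have hp : QuadraticMap.polar Q (v 0 • b 0) (∑ i : Fin n, v i.succ • b i.succ) =
        ∑ j : Fin n, QuadraticMap.polar Q (b 0) (b j.succ) * v 0 * v j.succ := by
      rw [← QuadraticMap.polarBilin_apply_apply, map_sum]
      refine Finset.sum_congr rfl fun j _ => ?_
      simp only [QuadraticMap.polarBilin_apply_apply, QuadraticMap.polar_smul_left,
        QuadraticMap.polar_smul_right, smul_eq_mul]
      ring
    simp only [Fin.sum_univ_succ (n := n), Fin.sum_Ioi_zero, Fin.sum_Ioi_succ]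
    rw [QuadraticMap.map_add Q, ih (fun i => b i.succ) (fun i => v i.succ), hp,
      QuadraticMap.map_smul, smul_eq_mul]
    ring

variable [CharZero k] {F : Type u} [Field F] [Algebra k F]

lemma extend_one_tmul (x : Fin n → k) : extend q F (1 ⊗ₜ[k] x) = algebraMap k F (q x) := by
  let : Invertible (2 : k) := invertibleOfNonzero two_ne_zero
  change q.baseChange F _ = _
  rw [QuadraticForm.baseChange_tmul, mul_one, Algebra.smul_def, mul_one]

/-- The coordinates on `F ⊗ kⁿ` given by the basis `1 ⊗ eᵢ`. -/
def extendCoord (k F : Type u) [Field k] [Field F] [Algebra k F] (n : ℕ) :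
    (Fin n → F) ≃ₗ[F] F ⊗[k] (Fin n → k) :=
  ((Algebra.TensorProduct.basis F (Pi.basisFun k (Fin n))).equivFun).symm

lemma extend_extendCoord (v : Fin n → F) :
    extend q F (extendCoord k F n v) = formVal q v := by
  have hc : extendCoord k F n v = ∑ i, v i • (1 ⊗ₜ[k] (Pi.single i (1 : k))) := by
    simp [extendCoord, Module.Basis.equivFun_symm_apply]
  rw [hc, map_sum_smul_eq, formVal_eq]
  simp only [QuadraticMap.polar, ← TensorProduct.tmul_add, extend_one_tmul, map_sub]

lemma extend_anisotropic_iff :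
    (extend q F).Anisotropic ↔ ∀ v : Fin n → F, formVal q v = 0 → v = 0 := by
  constructor
  · intro h v hv
    rw [← extend_extendCoord] at hv
    simpa using h _ hv
  · intro h x hx
    obtain ⟨v, rfl⟩ := (extendCoord k F n).surjective x
    rw [extend_extendCoord] at hx
    simp [h v hx]

lemma mem_valueGroup_of_formVal {v : Fin n → F} {d : Fˣ} (h : formVal q v = d) :
    d ∈ valueGroup (extend q F) :=
  Subgroup.subset_closure ⟨extendCoord k F n v, by rw [extend_extendCoord, h]⟩

lemma valueGroup_le_iff (H : Subgroup Fˣ) : valueGroup (extend q F) ≤ H ↔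
    ∀ (v : Fin n → F) (d : Fˣ), formVal q v = d → d ∈ H := by
  rw [valueGroup, Subgroup.closure_le]
  constructor
  · intro h v d hd
    exact h ⟨extendCoord k F n v, by rw [extend_extendCoord, hd]⟩
  · rintro h d ⟨x, hx⟩
    obtain ⟨v, rfl⟩ := (extendCoord k F n).surjective x
    rw [extend_extendCoord] at hx
    exact h v d hx

end

/-! ### Divisors of values of anisotropic forms -/

section
open Polynomial
variable {F : Type*} [Field F]

/-- The values at `0` and `1` of the polynomial `f` are nonzero and agree modulo `D`. -/
def EndsAgree (D : Subgroup Fˣ) (f : F[X]) : Prop :=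
  ∃ a b : Fˣ, f.eval 0 = a ∧ f.eval 1 = b ∧ a * b⁻¹ ∈ D

lemma EndsAgree.mul {D : Subgroup Fˣ} {f g : F[X]} (hf : EndsAgree D f) (hg : EndsAgree D g) :
    EndsAgree D (f * g) := by
  obtain ⟨a, b, ha, hb, h⟩ := hf
  obtain ⟨a', b', ha', hb', h'⟩ := hg
  refine ⟨a * a', b * b', by simp [ha, ha'], by simp [hb, hb'], ?_⟩
  rw [mul_inv, mul_mul_mul_comm]
  exact mul_mem h h'

lemma EndsAgree.of_mul_right {D : Subgroup Fˣ} {f g : F[X]} (hfg : EndsAgree D (f * g))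
    (hg : EndsAgree D g) : EndsAgree D f := by
  obtain ⟨a, b, ha, hb, h⟩ := hfg
  obtain ⟨a', b', ha', hb', h'⟩ := hg
  rw [eval_mul, ha'] at ha
  rw [eval_mul, hb'] at hb
  refine ⟨a * a'⁻¹, b * b'⁻¹, ?_, ?_, ?_⟩
  · simp [← ha]
  · simp [← hb]
  · rw [mul_inv, mul_mul_mul_comm, ← mul_inv]
    exact mul_mem h (inv_mem h')

lemma endsAgree_of_isUnit (D : Subgroup Fˣ) {f : F[X]} (hf : IsUnit f) : EndsAgree D f := by
  obtain ⟨c, hc, rfl⟩ := isUnit_iff.mp hf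
  obtain ⟨c, rfl⟩ := hc
  exact ⟨c, c, by simp, by simp, by simp⟩

lemma endsAgree_of_irreducible_factors (D : Subgroup Fˣ) {f : F[X]} (hf : f ≠ 0)
    (h : ∀ π, Irreducible π → π ∣ f → EndsAgree D π) : EndsAgree D f := by
  induction f using WfDvdMonoid.induction_on_irreducible with
  | zero => exact absurd rfl hf
  | unit u hu => exact endsAgree_of_isUnit D hu
  | mul a i ha hi ih =>
    exact (h i hi (dvd_mul_right _ _)).mul (ih ha fun π hπ hd => h π hπ (hd.mul_left _))

/-- A nonzero vector of polynomials is a multiple of a unimodular one. -/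
lemma exists_unimodular {n : ℕ} (r : Fin n → F[X]) (hr : ∃ i, r i ≠ 0) :
    ∃ (g : F[X]) (w : Fin n → F[X]), (∀ i, r i = g * w i) ∧ ∃ c : Fin n → F[X],
      ∑ i, c i * w i = 1 := by
  let I : Ideal F[X] := Ideal.span (Set.range r)
  let g := Submodule.IsPrincipal.generator I
  have hg (i : Fin n) : g ∣ r i :=
    (Submodule.IsPrincipal.mem_iff_generator_dvd I).mp (Ideal.subset_span ⟨i, rfl⟩)
  choose w hw using hg
  have hg0 : g ≠ 0 := by
    obtain ⟨i, hi⟩ := hr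
    intro h
    exact hi (by rw [hw i, h, zero_mul])
  obtain ⟨c, hc⟩ := Ideal.mem_span_range_iff_exists_fun.mp (Submodule.IsPrincipal.generator_mem I)
  refine ⟨g, w, hw, c, mul_left_cancel₀ hg0 ?_⟩
  rw [mul_one, Finset.mul_sum]
  refine Eq.trans (Finset.sum_congr rfl fun i _ => ?_) hc
  rw [hw i]
  ring

end

section
open Polynomial
variable {k F : Type u} [Field k] [Field F] [Algebra k F] {n : ℕ}
  {q : QuadraticForm k (Fin n → k)}

lemma eval_formVal (q : QuadraticForm k (Fin n → k)) (x : Fin n → F[X]) (t : F) :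
    (formVal q x).eval t = formVal q fun i => (x i).eval t := by
  have := map_formVal q ((aeval t).restrictScalars k : F[X] →ₐ[k] F) x
  simpa [Polynomial.coe_aeval_eq_eval] using this

/-- At every point a unimodular vector of polynomials takes a nonzero value, so an anisotropic
form takes a nonzero value on it. -/
lemma endsAgree_formVal_of_unimodular (han : ∀ v : Fin n → F, formVal q v = 0 → v = 0)
    {D : Subgroup Fˣ} (hD : ∀ (v : Fin n → F) (d : Fˣ), formVal q v = d → d ∈ D)
    {w c : Fin n → F[X]} (hw : ∑ i, c i * w i = 1) : EndsAgree D (formVal q w) := by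
  have key (a : F) : ∃ d : Fˣ, (formVal q w).eval a = d ∧ d ∈ D := by
    have hne : formVal q (fun i => (w i).eval a) ≠ 0 := by
      intro h
      have h0 := han _ h
      have h1 := congrArg (Polynomial.eval a) hw
      rw [eval_finsetSum, eval_one] at h1
      refine zero_ne_one (h1.symm.trans ?_).symm
      exact Finset.sum_eq_zero fun i _ => by rw [eval_mul, congrFun h0 i, Pi.zero_apply, mul_zero]
    exact ⟨Units.mk0 _ hne, eval_formVal q w a, hD _ _ rfl⟩
  obtain ⟨a, ha, haD⟩ := key 0
  obtain ⟨b, hb, hbD⟩ := key 1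
  exact ⟨a, b, ha, hb, mul_mem haD (inv_mem hbD)⟩

/-- The reduction step behind Knebusch's norm principle: if an anisotropic form becomes isotropic
over `F[X]/(π)`, then `π(0)` and `π(1)` agree modulo the group generated by its values. A vector
of small degree on which the form is divisible by `π` has a value `π h` with `deg h < deg π`, and
the irreducible factors of `h` again make the form isotropic. -/
lemma endsAgree_of_irreducible (han : ∀ v : Fin n → F, formVal q v = 0 → v = 0)
    {D : Subgroup Fˣ} (hD : ∀ (v : Fin n → F) (d : Fˣ), formVal q v = d → d ∈ D)
    {π : F[X]} (hπ : Irreducible π) {v : Fin n → F[X]} (hv : ∃ i, ¬ π ∣ v i)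
    (hdvd : π ∣ formVal q v) : EndsAgree D π := by
  induction hd : π.natDegree using Nat.strong_induction_on generalizing π v with
  | _ d ih =>
  subst hd
  have hpos : 0 < π.natDegree := hπ.natDegree_pos
  -- Reducing modulo `π` and dividing by the common factor makes `v` a unimodular vector `w` of
  -- degree less than `deg π`; the common factor is prime to `π`, again by its degree.
  let r : Fin n → F[X] := fun i => v i % π
  have hvr (i : Fin n) : π ∣ v i - r i :=
    ⟨v i / π, by rw [sub_eq_iff_eq_add]; exact (EuclideanDomain.div_add_mod _ _).symm⟩
  have hrdvd : π ∣ formVal q r := by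
    have := dvd_sub hdvd (dvd_formVal_sub q hvr)
    rwa [sub_sub_cancel] at this
  have hrdeg (i : Fin n) : (r i).natDegree < π.natDegree :=
    natDegree_mod_lt _ hpos.ne'
  obtain ⟨i, hi⟩ := hv
  have hri : r i ≠ 0 := by
    intro h
    have := hvr i
    rw [h, sub_zero] at this
    exact hi this
  obtain ⟨g, w, hgw, c, hcw⟩ := exists_unimodular r ⟨i, hri⟩
  have hwdeg (j : Fin n) : (w j).natDegree ≤ π.natDegree - 1 := by
    by_cases h : r j = 0
    · have hg0 : g ≠ 0 := by
        rintro rfl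
        exact hri (by rw [hgw i, zero_mul])
      have hw0 : w j = 0 := by
        rw [hgw j] at h
        exact (mul_eq_zero.mp h).resolve_left hg0
      simp [hw0]
    · have := natDegree_le_of_dvd (Dvd.intro_left g (hgw j).symm) h
      have := hrdeg j
      omega
  have hπg : ¬ π ∣ g := by
    intro h
    have h1 : π ∣ r i := h.trans (Dvd.intro _ (hgw i).symm)
    exact (natDegree_le_of_dvd h1 hri).not_gt (hrdeg i)
  have hπw : π ∣ formVal q w := by
    rw [show r = fun i => g * w i from funext hgw, formVal_smul] at hrdvd
    exact (hπ.prime.dvd_or_dvd hrdvd).resolve_left fun h => hπg (hπ.prime.dvd_of_dvd_pow h)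
  obtain ⟨h, hh⟩ := hπw
  have hV := endsAgree_formVal_of_unimodular han hD hcw
  have hV0 : formVal q w ≠ 0 := by
    obtain ⟨a, -, ha, -⟩ := hV
    intro h0
    rw [h0, eval_zero] at ha
    exact a.ne_zero ha.symm
  have hh0 : h ≠ 0 := by
    rintro rfl
    exact hV0 (by rw [hh, mul_zero])
  have hdeg := natDegree_formVal_le q w _ hwdeg
  rw [hh, natDegree_mul hπ.ne_zero hh0] at hdeg
  rw [hh] at hV
  refine hV.of_mul_right (endsAgree_of_irreducible_factors D hh0 fun ρ hρ hρh => ?_)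
  refine ih ρ.natDegree ?_ hρ (v := w) ?_ (hh ▸ hρh.mul_left π) rfl
  · have := natDegree_le_of_dvd hρh hh0
    omega
  · by_contra! hall
    exact hρ.not_isUnit (isUnit_of_dvd_one (hcw ▸ Finset.dvd_sum fun j _ => (hall j).mul_left _))

/-- A divisor of the value of an anisotropic form at a unimodular vector of polynomials takes the
same value at `0` and `1`, modulo the group generated by the values of the form. -/
theorem endsAgree_of_dvd_formVal (han : ∀ v : Fin n → F, formVal q v = 0 → v = 0)
    {D : Subgroup Fˣ} (hD : ∀ (v : Fin n → F) (d : Fˣ), formVal q v = d → d ∈ D)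
    {w c : Fin n → F[X]} (hw : ∑ i, c i * w i = 1) {f : F[X]} (hf : f ∣ formVal q w) :
    EndsAgree D f := by
  have hf0 : f ≠ 0 := by
    rintro rfl
    obtain ⟨a, -, ha, -⟩ := endsAgree_formVal_of_unimodular han hD hw
    rw [zero_dvd_iff.mp hf, eval_zero] at ha
    exact a.ne_zero ha.symm
  refine endsAgree_of_irreducible_factors D hf0 fun ρ hρ hρf =>
    endsAgree_of_irreducible han hD hρ (v := w) ?_ (hρf.trans hf)
  by_contra! hall
  exact hρ.not_isUnit (isUnit_of_dvd_one (hw ▸ Finset.dvd_sum fun j _ => (hall j).mul_left _))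

end

/-! ### Points of the quadric and their homotopies -/

section
variable {k : Type u} [Field k] [CharZero k] {F : Type u} [Field F] [Algebra k F] {m : ℕ}

/-- Extension of scalars preserves nondegeneracy. -/
lemma extend_nondegenerate {q : QuadraticForm k (Fin m → k)} (hq : q.Nondegenerate) :
    (extend q F).polarBilin.Nondegenerate := by
  let : Invertible (2 : k) := invertibleOfNonzero two_ne_zero
  let b := Algebra.TensorProduct.basis F (Pi.basisFun k (Fin m))
  have hM : LinearMap.BilinForm.toMatrix b (extend q F).polarBilin =
      (LinearMap.BilinForm.toMatrix (Pi.basisFun k (Fin m)) q.polarBilin).map (algebraMap k F) := by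
    ext i j
    simp only [LinearMap.BilinForm.toMatrix_apply, Matrix.map_apply, b,
      Algebra.TensorProduct.basis_apply, QuadraticMap.polarBilin_apply_apply, QuadraticMap.polar,
      ← TensorProduct.tmul_add, extend_one_tmul, map_sub]
  refine (LinearMap.BilinForm.nondegenerate_iff_det_ne_zero b).mpr ?_
  rw [hM, ← RingHom.mapMatrix_apply, ← RingHom.map_det, map_ne_zero]
  exact (LinearMap.BilinForm.nondegenerate_iff_det_ne_zero _).mp
    (QuadraticMap.nondegenerate_polar_iff.mpr hq)

/-- An isotropic nondegenerate form is universal. -/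
lemma exists_formVal_eq_of_isotropic {q : QuadraticForm k (Fin m → k)} (hq : q.Nondegenerate)
    {x : Fin m → F} (hx : x ≠ 0) (hqx : formVal q x = 0) (c : F) : ∃ y, formVal q y = c := by
  let X := extendCoord k F m x
  have hX : X ≠ 0 := by simpa [X] using hx
  obtain ⟨Y, hY⟩ : ∃ Y, (extend q F).polarBilin X Y ≠ 0 := by
    by_contra! h
    exact hX ((extend_nondegenerate hq).1 X h)
  rw [QuadraticMap.polarBilin_apply_apply] at hY
  let t := (c - extend q F Y) / QuadraticMap.polar (extend q F) X Y
  obtain ⟨y, hy⟩ := (extendCoord k F m).surjective (t • X + Y)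
  refine ⟨y, ?_⟩
  rw [← extend_extendCoord, hy, QuadraticMap.map_add (extend q F), QuadraticMap.map_smul,
    QuadraticMap.polar_smul_left, extend_extendCoord, hqx]
  simp only [smul_eq_mul, mul_zero, zero_add, t]
  field_simp
  ring

end

section
variable {k : Type u} [Field k] {m : ℕ} (φ' : QuadraticForm k (Fin m → k))

lemma formVal_psi {R : Type*} [CommRing R] [Algebra k R] (v : Fin (m + 2) → R) :
    formVal (psi φ') v = v 0 ^ 2 - v 1 ^ 2 + formVal φ' (fun i => v i.succ.succ) := by
  rw [psi, formVal_consForm, formVal_consForm]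
  simp
  ring

lemma formVal_phi {R : Type*} [CommRing R] [Algebra k R] (v : Fin (m + 1) → R) :
    formVal (phi φ') v = v 0 ^ 2 - formVal φ' (fun i => v i.succ) := by
  rw [phi, formVal_consForm, formVal_neg]
  simp
  ring

/-- The function `x₂ = y₁ - y₂` on the quadric. -/
def x₂ : CoordRing (psi φ') := Ideal.Quotient.mk _ (MvPolynomial.X 0 - MvPolynomial.X 1)

/-- The coordinate functions `x₃, x₄, …` on the quadric. -/
def xRest (i : Fin m) : CoordRing (psi φ') := Ideal.Quotient.mk _ (MvPolynomial.X i.succ.succ)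

variable {φ'} {R : Type*} [CommRing R] [Algebra k R]

/-- The equation `x₁ x₂ = φ(1, x₃, …) = 1 - φ'(x₃, …)` of the quadric. -/
lemma quadric_equation (p : CoordRing (psi φ') →ₐ[k] R) :
    p (x₁ φ') * p (x₂ φ') = 1 - formVal φ' (fun i => p (xRest φ' i)) := by
  let mkA := Ideal.Quotient.mkₐ k (Ideal.span {formPolynomial (psi φ') - 1})
  let y : Fin (m + 2) → CoordRing (psi φ') := fun i => mkA (MvPolynomial.X i)
  have h1 : formVal (psi φ') y = 1 := by
    have h2 : formVal (psi φ') y = mkA (formPolynomial (psi φ')) := by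
      change formVal (psi φ') (fun i => mkA (MvPolynomial.X i)) = _
      rw [← map_formVal, formVal, MvPolynomial.aeval_X_left_apply]
    rw [h2, ← map_one mkA]
    exact (Ideal.Quotient.mk_eq_mk_iff_sub_mem _ _).mpr (Ideal.mem_span_singleton_self _)
  have h3 : x₁ φ' * x₂ φ' = 1 - formVal φ' (xRest φ') := by
    rw [formVal_psi] at h1
    have hx₁ : x₁ φ' = y 0 + y 1 := map_add mkA _ _
    have hx₂ : x₂ φ' = y 0 - y 1 := map_sub mkA _ _
    change _ + formVal φ' (xRest φ') = 1 at h1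
    rw [hx₁, hx₂]
    linear_combination h1
  rw [← map_mul, h3, map_sub, map_one, map_formVal]

variable [CharZero k]

lemma coordRing_hom_ext {p q : CoordRing (psi φ') →ₐ[k] R} (h₁ : p (x₁ φ') = q (x₁ φ'))
    (h₂ : p (x₂ φ') = q (x₂ φ')) (h : ∀ i, p (xRest φ' i) = q (xRest φ' i)) : p = q := by
  let mkA := Ideal.Quotient.mkₐ k (Ideal.span {formPolynomial (psi φ') - 1})
  have hx₁ : x₁ φ' = mkA (.X 0) + mkA (.X 1) := map_add mkA _ _
  have hx₂ : x₂ φ' = mkA (.X 0) - mkA (.X 1) := map_sub mkA _ _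
  have h2 : (2 : k) ≠ 0 := two_ne_zero
  have h0' : mkA (.X 0) = (2⁻¹ : k) • (x₁ φ' + x₂ φ') := by
    rw [eq_inv_smul_iff₀ h2, hx₁, hx₂, ofNat_smul_eq_nsmul, two_nsmul]
    ring
  have h1' : mkA (.X 1) = (2⁻¹ : k) • (x₁ φ' - x₂ φ') := by
    rw [eq_inv_smul_iff₀ h2, hx₁, hx₂, ofNat_smul_eq_nsmul, two_nsmul]
    ring
  apply Ideal.Quotient.algHom_ext
  apply MvPolynomial.algHom_ext
  intro i
  change p (mkA (.X i)) = q (mkA (.X i))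
  refine Fin.cases ?_ (fun i => Fin.cases ?_ (fun i => h i) i) i
  · rw [h0', map_smul, map_smul, map_add, map_add, h₁, h₂]
  · change p (mkA (.X 1)) = q (mkA (.X 1))
    rw [h1', map_smul, map_smul, map_sub, map_sub, h₁, h₂]

/-- The point of the quadric with coordinates `x₁ = a`, `x₂ = b` and `x₃, … = x`. -/
lemma exists_quadricPoint (a b : R) (x : Fin m → R) (h : a * b = 1 - formVal φ' x) :
    ∃ p : CoordRing (psi φ') →ₐ[k] R,
      p (x₁ φ') = a ∧ p (x₂ φ') = b ∧ ∀ i, p (xRest φ' i) = x i := by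
  let e : R := algebraMap k R 2⁻¹
  have he : 2 * e = 1 := by
    change 2 * algebraMap k R 2⁻¹ = 1
    rw [← map_ofNat (algebraMap k R) 2, ← map_mul, mul_inv_cancel₀ two_ne_zero, map_one]
  let y : Fin (m + 2) → R := Fin.cons (e * (a + b)) (Fin.cons (e * (a - b)) x)
  have hy : formVal (psi φ') y = 1 := by
    rw [formVal_psi]
    change (e * (a + b)) ^ 2 - (e * (a - b)) ^ 2 + formVal φ' x = 1
    linear_combination h + a * b * (2 * e + 1) * he
  let p : CoordRing (psi φ') →ₐ[k] R := Ideal.Quotient.liftₐ _ (MvPolynomial.aeval y) (by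
    intro f hf
    have hle : Ideal.span {formPolynomial (psi φ') - 1} ≤
        RingHom.ker (MvPolynomial.aeval (R := k) y) := by
      rw [Ideal.span_singleton_le_iff_mem, RingHom.mem_ker, map_sub, map_one, sub_eq_zero]
      exact hy
    exact hle hf)
  have hp (f) : p (Ideal.Quotient.mk _ f) = MvPolynomial.aeval y f := rfl
  refine ⟨p, ?_, ?_, fun i => ?_⟩
  · rw [x₁, hp, map_add, MvPolynomial.aeval_X, MvPolynomial.aeval_X]
    change e * (a + b) + e * (a - b) = a
    linear_combination a * he
  · rw [x₂, hp, map_sub, MvPolynomial.aeval_X, MvPolynomial.aeval_X]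
    change e * (a + b) - e * (a - b) = b
    linear_combination b * he
  · rw [xRest, hp, MvPolynomial.aeval_X]
    rfl

end

section
open Polynomial
variable {k F : Type u} [Field k] [CharZero k] [Field F] [Algebra k F] {m : ℕ}
  {φ' : QuadraticForm k (Fin m → k)}

lemma pointHomotopic_of_path {p q : CoordRing (psi φ') →ₐ[k] F} (a b : F[X]) (x : Fin m → F[X])
    (h : a * b = 1 - formVal φ' x)
    (hp₁ : a.eval 0 = p (x₁ φ')) (hp₂ : b.eval 0 = p (x₂ φ'))
    (hp : ∀ i, (x i).eval 0 = p (xRest φ' i))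
    (hq₁ : a.eval 1 = q (x₁ φ')) (hq₂ : b.eval 1 = q (x₂ φ'))
    (hq : ∀ i, (x i).eval 1 = q (xRest φ' i)) : PointHomotopic p q := by
  obtain ⟨P, h₁, h₂, h₃⟩ := exists_quadricPoint a b x h
  have h0 : ((aeval 0).restrictScalars k : F[X] →ₐ[k] F).comp P = p := by
    apply coordRing_hom_ext <;> simp [h₁, h₂, h₃, coe_aeval_eq_eval, hp₁, hp₂, hp]
  have h1 : ((aeval 1).restrictScalars k : F[X] →ₐ[k] F).comp P = q := by
    apply coordRing_hom_ext <;> simp [h₁, h₂, h₃, coe_aeval_eq_eval, hq₁, hq₂, hq]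
  refine ⟨P, fun c => ⟨?_, ?_⟩⟩
  · rw [← h0]; simp [coe_aeval_eq_eval]
  · rw [← h1]; simp [coe_aeval_eq_eval]

/-- Points with the same nonzero `x₁` are joined by the line through their remaining coordinates,
`x₂` being determined by the equation. -/
lemma pointHomotopic_of_x₁_eq {p q : CoordRing (psi φ') →ₐ[k] F} (h : p (x₁ φ') = q (x₁ φ'))
    (h0 : p (x₁ φ') ≠ 0) : PointHomotopic p q := by
  let x : Fin m → F[X] := fun i => C (p (xRest φ' i)) + X * C (q (xRest φ' i) - p (xRest φ' i))
  refine pointHomotopic_of_path (C (p (x₁ φ'))) (C (p (x₁ φ'))⁻¹ * (1 - formVal φ' x)) x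
    ?_ ?_ ?_ ?_ ?_ ?_ ?_
  · rw [← mul_assoc, ← C_mul, mul_inv_cancel₀ h0, C_1, one_mul]
  · simp
  · rw [eval_mul, eval_C, inv_mul_eq_iff_eq_mul₀ h0, quadric_equation, eval_sub, eval_one,
      eval_formVal]
    simp [x]
  · simp [x]
  · simp [h]
  · rw [eval_mul, eval_C, inv_mul_eq_iff_eq_mul₀ h0, h, quadric_equation, eval_sub, eval_one,
      eval_formVal]
    simp [x]
  · simp [x]

lemma pointHomotopic_of_x₂_eq {p q : CoordRing (psi φ') →ₐ[k] F} (h : p (x₂ φ') = q (x₂ φ'))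
    (h0 : p (x₂ φ') ≠ 0) : PointHomotopic p q := by
  let x : Fin m → F[X] := fun i => C (p (xRest φ' i)) + X * C (q (xRest φ' i) - p (xRest φ' i))
  refine pointHomotopic_of_path ((1 - formVal φ' x) * C (p (x₂ φ'))⁻¹) (C (p (x₂ φ'))) x
    ?_ ?_ ?_ ?_ ?_ ?_ ?_
  · rw [mul_assoc, ← C_mul, inv_mul_cancel₀ h0, C_1, mul_one]
  · rw [eval_mul, eval_C, mul_inv_eq_iff_eq_mul₀ h0, quadric_equation, eval_sub, eval_one,
      eval_formVal]
    simp [x]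
  · simp
  · simp [x]
  · rw [eval_mul, eval_C, mul_inv_eq_iff_eq_mul₀ h0, h, quadric_equation, eval_sub, eval_one,
      eval_formVal]
    simp [x]
  · simp [h]
  · simp [x]

/-- On the locus `x₂ = 0` the equation does not involve `x₁`, which may vary freely. -/
lemma pointHomotopic_of_x₂_eq_zero {p q : CoordRing (psi φ') →ₐ[k] F} (hp : p (x₂ φ') = 0)
    (hq : q (x₂ φ') = 0) (h : ∀ i, p (xRest φ' i) = q (xRest φ' i)) : PointHomotopic p q := by
  refine pointHomotopic_of_path (C (p (x₁ φ')) + X * C (q (x₁ φ') - p (x₁ φ'))) 0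
    (fun i => C (p (xRest φ' i))) ?_ (by simp) (by simp [hp]) (by simp) (by simp) (by simp [hq])
    (by simp [h])
  have h1 := quadric_equation p
  rw [hp, mul_zero] at h1
  have h2 := map_formVal φ' ((CAlgHom (R := k)) : F →ₐ[k] F[X]) (fun i => p (xRest φ' i))
  rw [← sub_eq_zero.mp h1.symm, map_one] at h2
  rw [mul_zero, eq_comm, sub_eq_zero]
  exact h2

end

/-! ### Classification of the points up to homotopy -/

section
variable {k F : Type u} [Field k] [CharZero k] [Field F] [Algebra k F] {m : ℕ}
  {φ' : QuadraticForm k (Fin m → k)}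

/-- If `φ_F` is isotropic, then it already vanishes at a vector with first coordinate `1`. -/
lemma exists_formVal_eq_one_of_isotropic (hφ' : φ'.Nondegenerate)
    (h : ¬ (extend (phi φ') F).Anisotropic) : ∃ x : Fin m → F, formVal φ' x = 1 := by
  rw [extend_anisotropic_iff] at h
  push Not at h
  obtain ⟨v, hv, hv0⟩ := h
  rw [formVal_phi, sub_eq_zero] at hv
  by_cases h0 : v 0 = 0
  · refine exists_formVal_eq_of_isotropic hφ' (x := fun i => v i.succ) (fun h => hv0 ?_) ?_ 1
    · ext i
      exact Fin.cases h0 (fun i => congrFun h i) i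
    · rw [← hv, h0, zero_pow two_ne_zero]
  · refine ⟨fun i => (v 0)⁻¹ * v i.succ, ?_⟩
    rw [formVal_smul, ← hv, ← mul_pow, inv_mul_cancel₀ h0, one_pow]

lemma not_anisotropic_of_x₁_eq_zero (p : CoordRing (psi φ') →ₐ[k] F) (hp : p (x₁ φ') = 0) :
    ¬ (extend (phi φ') F).Anisotropic := by
  rw [extend_anisotropic_iff]
  intro h
  have h1 := quadric_equation p
  rw [hp, zero_mul] at h1
  have h2 := h (Fin.cons 1 fun i => p (xRest φ' i)) (by
    rw [formVal_phi]
    simpa using h1.symm)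
  simpa using congrFun h2 0

/-- An isotropic `φ_F` is universal, so its values generate `Fˣ`. -/
lemma valueGroup_eq_top_of_isotropic (hφ' : φ'.Nondegenerate)
    (h : ¬ (extend (phi φ') F).Anisotropic) : valueGroup (extend (phi φ') F) = ⊤ := by
  obtain ⟨x, hx⟩ := exists_formVal_eq_one_of_isotropic hφ' h
  have : CharZero F := charZero_of_injective_algebraMap (algebraMap k F).injective
  rw [eq_top_iff]
  rintro d -
  -- `φ(t + 1, t x) = 2 t + 1` takes every value.
  let t : F := (d - 1) / 2
  refine mem_valueGroup_of_formVal (phi φ') (v := Fin.cons (t + 1) fun i => t * x i) ?_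
  rw [formVal_phi]
  simp only [Fin.cons_zero, Fin.cons_succ, formVal_smul, hx, t]
  field_simp
  ring

/-- The point `x₁ = a`, `x₂ = a⁻¹`, `x₃ = ⋯ = 0`. -/
lemma exists_basePoint (a : Fˣ) : ∃ p : CoordRing (psi φ') →ₐ[k] F,
    p (x₁ φ') = a ∧ p (x₂ φ') = ((a⁻¹ : Fˣ) : F) ∧ ∀ i, p (xRest φ' i) = 0 := by
  refine exists_quadricPoint (a : F) ((a⁻¹ : Fˣ) : F) 0 ?_
  rw [formVal_zero, sub_zero, Units.mul_inv]

/-- If `φ_F` is isotropic, all `F`-points are chain homotopic. -/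
lemma quot_pointHomotopic_subsingleton (hφ' : φ'.Nondegenerate)
    (h : ¬ (extend (phi φ') F).Anisotropic) (p q : CoordRing (psi φ') →ₐ[k] F) :
    Quot.mk PointHomotopic p = Quot.mk PointHomotopic q := by
  obtain ⟨x, hx⟩ := exists_formVal_eq_one_of_isotropic hφ' h
  choose P hP₁ hP₂ hP₃ using fun a : F =>
    exists_quadricPoint (φ' := φ') a 0 x (by rw [mul_zero, hx, sub_self])
  have hP (a b : F) : Quot.mk PointHomotopic (P a) = Quot.mk PointHomotopic (P b) :=
    Quot.sound (pointHomotopic_of_x₂_eq_zero (hP₂ a) (hP₂ b) fun i => by rw [hP₃, hP₃])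
  have key₁ (p : CoordRing (psi φ') →ₐ[k] F) (hp : p (x₁ φ') ≠ 0) :
      Quot.mk PointHomotopic p = Quot.mk PointHomotopic (P 1) :=
    (Quot.sound (pointHomotopic_of_x₁_eq (hP₁ _).symm hp)).trans (hP _ 1)
  have key (p : CoordRing (psi φ') →ₐ[k] F) :
      Quot.mk PointHomotopic p = Quot.mk PointHomotopic (P 1) := by
    by_cases h₁ : p (x₁ φ') = 0
    · by_cases h₂ : p (x₂ φ') = 0
      · obtain ⟨q, hq₁, hq₂, hq₃⟩ := exists_quadricPoint (φ' := φ') 1 0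
          (fun i => p (xRest φ' i)) (by rw [← quadric_equation, h₂, mul_zero, mul_zero])
        rw [← key₁ q (by rw [hq₁]; exact one_ne_zero)]
        exact Quot.sound (pointHomotopic_of_x₂_eq_zero h₂ hq₂ fun i => (hq₃ i).symm)
      · obtain ⟨q, hq₁, hq₂, hq₃⟩ := exists_basePoint (φ' := φ') (Units.mk0 _ h₂)⁻¹
        rw [← key₁ q (by rw [hq₁]; exact Units.ne_zero _)]
        refine Quot.sound (pointHomotopic_of_x₂_eq ?_ h₂)
        rw [hq₂, inv_inv, Units.val_mk0]
    · exact key₁ p h₁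
  rw [key p, key q]

/-- The units by which the coordinate `x₁ ≠ 0` of a point can be multiplied without changing its
chain homotopy class. -/
def stableUnits (φ' : QuadraticForm k (Fin m → k)) (F : Type u) [Field F] [Algebra k F] :
    Subgroup Fˣ where
  carrier := {d | ∀ p q : CoordRing (psi φ') →ₐ[k] F, p (x₁ φ') ≠ 0 →
    q (x₁ φ') = p (x₁ φ') * d → Quot.mk PointHomotopic p = Quot.mk PointHomotopic q}
  one_mem' p q hp h := Quot.sound (pointHomotopic_of_x₁_eq (by simpa using h.symm) hp)
  mul_mem' {c d} hc hd p q hp h := by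
    obtain ⟨r, hr, -, -⟩ := exists_basePoint (φ' := φ') (Units.mk0 _ hp * c)
    rw [Units.val_mul, Units.val_mk0] at hr
    refine (hc p r hp hr).trans (hd r q ?_ ?_)
    · rw [hr]
      exact mul_ne_zero hp c.ne_zero
    · rw [h, hr, Units.val_mul, mul_assoc]
  inv_mem' {d} hd p q hp h := by
    refine (hd q p ?_ ?_).symm
    · rw [h]
      exact mul_ne_zero hp (Units.ne_zero _)
    · rw [h, mul_assoc, Units.inv_mul, mul_one]

lemma mem_stableUnits_of_affine (x : Fin m → F) (d : Fˣ) (h : 1 - formVal φ' x = d) :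
    d ∈ stableUnits φ' F := by
  intro p q hp hq
  let a := Units.mk0 _ hp
  -- The point `(a d, a⁻¹, x)` shares `x₁` with `q` and `x₂` with the base point `(a, a⁻¹, 0)`.
  obtain ⟨r, hr₁, hr₂, -⟩ := exists_quadricPoint (φ' := φ') (a * d : F) (a⁻¹ : Fˣ) x (by
    rw [h, mul_right_comm, Units.mul_inv, one_mul])
  obtain ⟨s, hs₁, hs₂, -⟩ := exists_basePoint (φ' := φ') a
  have h1 : Quot.mk PointHomotopic p = Quot.mk PointHomotopic s :=
    Quot.sound (pointHomotopic_of_x₁_eq hs₁.symm hp)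
  have h2 : Quot.mk PointHomotopic s = Quot.mk PointHomotopic r :=
    Quot.sound (pointHomotopic_of_x₂_eq (hs₂.trans hr₂.symm) (by rw [hs₂]; exact Units.ne_zero _))
  have h3 : Quot.mk PointHomotopic r = Quot.mk PointHomotopic q :=
    Quot.sound (pointHomotopic_of_x₁_eq (hr₁.trans hq.symm)
      (by rw [hr₁]; exact mul_ne_zero hp d.ne_zero))
  exact h1.trans (h2.trans h3)

/-- The restriction of `φ_F` to the plane spanned by `(1, 0)` and `(0, x)` is the norm form
`s² + c t²` with `c = -φ'(x)`. -/
lemma norm_ne_zero_of_anisotropic (h : (extend (phi φ') F).Anisotropic) {x : Fin m → F}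
    (hx : x ≠ 0) {s t : F} (hst : s ≠ 0 ∨ t ≠ 0) : s ^ 2 - t ^ 2 * formVal φ' x ≠ 0 := by
  intro h0
  have h1 := (extend_anisotropic_iff _).mp h (Fin.cons s fun i => t * x i) (by
    rw [formVal_phi]
    simpa [formVal_smul] using h0)
  have hs : s = 0 := by simpa using congrFun h1 0
  obtain ⟨i, hi⟩ := Function.ne_iff.mp hx
  have ht : t * x i = 0 := by simpa using congrFun h1 i.succ
  exact hst.elim (· hs) (· ((mul_eq_zero.mp ht).resolve_right hi))

lemma mem_stableUnits_of_norm {x : Fin m → F} {t : F} {d : Fˣ}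
    (hd : 1 - t ^ 2 * formVal φ' x = d) : d ∈ stableUnits φ' F :=
  mem_stableUnits_of_affine (fun i => t * x i) d (by rw [formVal_smul, hd])

/-- Squares are stable: with `c = -φ'(x) ≠ 0` and `N(t) = 1 + c t²` one has
`N(t) N(u) = (1 - c t u)² N((t + u) / (1 - c t u))`, and `1 - c t u` is arbitrary. -/
lemma sq_mem_stableUnits (hm : 1 ≤ m) (h : (extend (phi φ') F).Anisotropic) (s : Fˣ) :
    s ^ 2 ∈ stableUnits φ' F := by
  let x : Fin m → F := fun _ => 1
  have hx : x ≠ 0 := fun h => one_ne_zero (congrFun h ⟨0, hm⟩)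
  let c := formVal φ' x
  have hc : c ≠ 0 := by
    have := norm_ne_zero_of_anisotropic h hx (s := 0) (t := 1) (Or.inr one_ne_zero)
    simpa using this
  have hN (t : F) : 1 - t ^ 2 * c ≠ 0 := by
    have := norm_ne_zero_of_anisotropic h hx (s := 1) (t := t) (Or.inl one_ne_zero)
    simpa using this
  have hs := s.ne_zero
  -- These solve `1 + c t = s` and `(t + 1) / (1 + c t) = u`, that is, the identity for `N(t) N(1)`,
  -- with `c` of the opposite sign.
  let t : F := (s - 1) / c
  let u : F := (t + 1) / s
  have h1 : s ^ 2 = Units.mk0 _ (hN t) * Units.mk0 _ (hN 1) * (Units.mk0 _ (hN u))⁻¹ := by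
    rw [eq_mul_inv_iff_mul_eq]
    ext
    simp only [Units.val_mul, Units.val_pow_eq_pow_val, Units.val_mk0, t, u]
    field_simp
    ring
  rw [h1]
  exact mul_mem (mul_mem (mem_stableUnits_of_norm rfl) (mem_stableUnits_of_norm rfl))
    (inv_mem (mem_stableUnits_of_norm rfl))

/-- A value `φ(s, x)` is `s² φ(1, x / s)` if `s ≠ 0`, and a value `d = φ(0, x)` is a square times a
quotient of values of the form `1 + d t²`. -/
lemma valueGroup_le_stableUnits (hm : 1 ≤ m) (h : (extend (phi φ') F).Anisotropic) :
    valueGroup (extend (phi φ') F) ≤ stableUnits φ' F := by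
  rw [valueGroup_le_iff]
  intro v d hd
  rw [formVal_phi] at hd
  have hd0 := d.ne_zero
  by_cases h0 : v 0 = 0
  · let x : Fin m → F := fun i => v i.succ
    have hdx : (d : F) = -formVal φ' x := by rw [← hd, h0]; ring
    have hx : x ≠ 0 := by
      intro hx
      rw [hx, formVal_zero, neg_zero] at hdx
      exact hd0 hdx
    have hN (t : F) : 1 - t ^ 2 * formVal φ' x ≠ 0 := by
      have := norm_ne_zero_of_anisotropic h hx (s := 1) (t := t) (Or.inl one_ne_zero)
      simpa using this
    -- `d (1 + d) = d² (1 + d (1 / d)²)`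
    have h1 : d = d ^ 2 * Units.mk0 _ (hN (d : F)⁻¹) * (Units.mk0 _ (hN 1))⁻¹ := by
      rw [eq_mul_inv_iff_mul_eq]
      ext
      simp only [Units.val_mul, Units.val_pow_eq_pow_val, Units.val_mk0]
      rw [show formVal φ' x = -d by rw [hdx, neg_neg]]
      field_simp
      ring
    rw [h1]
    exact mul_mem (mul_mem (sq_mem_stableUnits hm h d) (mem_stableUnits_of_norm rfl))
      (inv_mem (mem_stableUnits_of_norm rfl))
  · let s := Units.mk0 _ h0
    have h1 : d = s ^ 2 * ((s⁻¹) ^ 2 * d) := by rw [← mul_assoc, ← mul_pow, mul_inv_cancel,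
      one_pow, one_mul]
    rw [h1]
    refine mul_mem (sq_mem_stableUnits hm h s)
      (mem_stableUnits_of_affine (fun i => (v 0)⁻¹ * v i.succ) _ ?_)
    rw [formVal_smul, Units.val_mul, ← hd, Units.val_pow_eq_pow_val, Units.val_inv_eq_inv_val,
      Units.val_mk0]
    field_simp

/-- In the anisotropic case directly homotopic points have `x₁` agreeing modulo values of `φ_F`:
along a homotopy, `x₁` divides the value of `φ` at the unimodular vector `(1, x₃, …)`. -/
lemma div_mem_valueGroup_of_pointHomotopic (h : (extend (phi φ') F).Anisotropic)
    {p q : CoordRing (psi φ') →ₐ[k] F} (hpq : PointHomotopic p q) {a b : Fˣ}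
    (ha : p (x₁ φ') = a) (hb : q (x₁ φ') = b) : a * b⁻¹ ∈ valueGroup (extend (phi φ') F) := by
  obtain ⟨P, hP⟩ := hpq
  let w : Fin (m + 1) → Polynomial F := Fin.cons 1 fun i => P (xRest φ' i)
  have hw : ∑ i, (Pi.single 0 1 : Fin (m + 1) → Polynomial F) i * w i = 1 := by
    rw [Fin.sum_univ_succ]
    simp [w]
  have hdvd : P (x₁ φ') ∣ formVal (phi φ') w := by
    refine ⟨P (x₂ φ'), ?_⟩
    rw [quadric_equation, formVal_phi]
    simp [w]
  obtain ⟨a', b', ha', hb', hab⟩ := endsAgree_of_dvd_formVal ((extend_anisotropic_iff _).mp h)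
    (fun v d hd => mem_valueGroup_of_formVal (phi φ') hd) hw hdvd
  have h1 : a' = a := Units.ext (by rw [← ha', (hP _).1, ha])
  have h2 : b' = b := Units.ext (by rw [← hb', (hP _).2, hb])
  rwa [← h1, ← h2]

/-- Chain homotopy classes of `F`-points of the quadric are classified by `x₁` modulo the values
of `φ_F`. -/
theorem exists_equiv_quot_pointHomotopic (hm : 1 ≤ m) (hφ' : φ'.Nondegenerate) :
    ∃ e : Quot (PointHomotopic (k := k) (C := CoordRing (psi φ')) (R := F)) ≃
        Fˣ ⧸ valueGroup (extend (phi φ') F),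
      ∀ (p : CoordRing (psi φ') →ₐ[k] F) (a : Fˣ), p (x₁ φ') = a → e (Quot.mk _ p) = a := by
  by_cases h : (extend (phi φ') F).Anisotropic
  · have hne (p : CoordRing (psi φ') →ₐ[k] F) : p (x₁ φ') ≠ 0 :=
      fun h0 => not_anisotropic_of_x₁_eq_zero p h0 h
    let f : Quot (PointHomotopic (k := k) (C := CoordRing (psi φ')) (R := F)) →
        Fˣ ⧸ valueGroup (extend (phi φ') F) :=
      Quot.lift (fun p => ((Units.mk0 _ (hne p) : Fˣ) : Fˣ ⧸ _)) fun p q hpq => by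
        rw [eq_comm, QuotientGroup.eq, mul_comm]
        exact div_mem_valueGroup_of_pointHomotopic h hpq rfl rfl
    have hf : Function.Bijective f := by
      constructor
      · rintro ⟨p⟩ ⟨q⟩ hpq
        refine valueGroup_le_stableUnits hm h (QuotientGroup.eq.mp hpq) p q (hne p) ?_
        rw [Units.val_mul, ← mul_assoc]
        change _ = ((Units.mk0 _ (hne p) : Fˣ) : F) * _ * _
        rw [Units.mul_inv, one_mul, Units.val_mk0]
      · intro z
        obtain ⟨a, rfl⟩ := QuotientGroup.mk_surjective z
        obtain ⟨p, hp, -, -⟩ := exists_basePoint (φ' := φ') a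
        exact ⟨Quot.mk _ p, congrArg _ (Units.ext hp)⟩
    exact ⟨Equiv.ofBijective f hf, fun p a ha => congrArg _ (Units.ext ha)⟩
  · have htop := valueGroup_eq_top_of_isotropic hφ' h
    have : Subsingleton (Fˣ ⧸ valueGroup (extend (phi φ') F)) :=
      QuotientGroup.subsingleton_iff.mpr htop
    have : Subsingleton (Quot (PointHomotopic (k := k) (C := CoordRing (psi φ')) (R := F))) :=
      ⟨by rintro ⟨p⟩ ⟨q⟩; exact quot_pointHomotopic_subsingleton hφ' h p q⟩
    obtain ⟨p, -⟩ := exists_basePoint (φ' := φ') (1 : Fˣ)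
    exact ⟨equivOfSubsingletonOfSubsingleton (fun _ => 1) fun _ => Quot.mk _ p,
      fun _ _ _ => Subsingleton.elim _ _⟩

end
end AffineQuadric

end

theorem theorem4p4 {k : Type u} [Field k] [CharZero k] {m : ℕ} (hm : 1 ≤ m)
    (φ' : QuadraticForm k (Fin m → k)) (hφ' : φ'.Nondegenerate)
    (F : Type u) [Field F] [Algebra k F] (hF : (⊤ : IntermediateField k F).FG) :
    -- the assignment `P ↦ x₁(P)` takes values in `Fˣ` unless `Fˣ ⧸ ⟨D(φ_F)⟩` is trivial
    (∀ p : AffineQuadric.CoordRing (AffineQuadric.psi φ') →ₐ[k] F,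
      p (AffineQuadric.x₁ φ') = 0 →
        ¬ (AffineQuadric.extend (AffineQuadric.phi φ') F).Anisotropic) ∧
    (¬ (AffineQuadric.extend (AffineQuadric.phi φ') F).Anisotropic →
      AffineQuadric.valueGroup (AffineQuadric.extend (AffineQuadric.phi φ') F) = ⊤) ∧
    -- and it induces a bijection `𝒮(Q^ψ)(F) ≃ Fˣ ⧸ ⟨D(φ_F)⟩`
    ∃ Φ : NaiveA1.componentsAt (AffineQuadric.quadric (AffineQuadric.psi φ')) F ≃
        Fˣ ⧸ AffineQuadric.valueGroup (AffineQuadric.extend (AffineQuadric.phi φ') F),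
      ∀ p : AffineQuadric.CoordRing (AffineQuadric.psi φ') →ₐ[k] F,
        (∃ s, NaiveA1.IsClassOf _ (AffineQuadric.toPoint p) s) ∧
        ∀ s, NaiveA1.IsClassOf _ (AffineQuadric.toPoint p) s →
          ∀ a : Fˣ, p (AffineQuadric.x₁ φ') = a → Φ s = (a : Fˣ ⧸ _) := by
  refine ⟨AffineQuadric.not_anisotropic_of_x₁_eq_zero,
    AffineQuadric.valueGroup_eq_top_of_isotropic hφ', ?_⟩
  have := NaiveA1.nonempty_smoothModel hF
  obtain ⟨e, he⟩ := NaiveA1.exists_equiv_componentsAt (k := k) (F := F)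
    (C := AffineQuadric.CoordRing (AffineQuadric.psi φ'))
  obtain ⟨e', he'⟩ := AffineQuadric.exists_equiv_quot_pointHomotopic (F := F) hm hφ'
  refine ⟨e.trans e', fun p => ⟨⟨e.symm (Quot.mk _ p), ?_⟩, fun s hs a ha => ?_⟩⟩
  · exact (he p _).mpr (e.apply_symm_apply _)
  · exact (congrArg e' ((he p s).mp hs)).trans (he' p a ha)
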